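/- Let $r\ge 1$ and $k\ge 2$ be integers. The simple objects of $\mathcal C(\mathfrak{sl}_{r+1},k)$ are the formal sums $X=\sum_{i=0}^r\lambda_i\Lambda_i$ with $\lambda_i\in\mathbb N$ and $\sum_{i=0}^r\lambda_i=k$; the indices are read modulo $r+1$, and the term $\lambda_0\Lambda_0$ is usually omitted, so that e.g. $a\Lambda_b$ stands for $(k-a)\Lambda_0+a\Lambda_b$ and $\Lambda_1+\Lambda_r$ for $(k-2)\Lambda_0+\Lambda_1+\Lambda_r$. Put $q=e^{2\pi i/(2(1+k+r))}$ and $[n]=\frac{q^n-q^{-n}}{q-q^{-1}}$. The quantum dimension of $X$ is given by the hook formula $$\dim(X)=\prod_{(x,y)\in T(X)}\frac{[r+1-x+y]}{[h(x,y)]},$$ where $T(X)$ is the Young diagram whose $j$-th row ($1\le j\le r$) has $\sum_{i=j}^r\lambda_i$ boxes, $(x,y)$ runs over its boxes ($x$ the row, $y$ the column), and $h(x,y)$ is the hook length. The simple-current orbit $[X]$ is the set of all $\sum_i\lambda_i\Lambda_{i+a}$ with $a\in\mathbb Z/(r+1)$, and $X^*=\sum_i\lambda_i\Lambda_{-i}$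 is the charge conjugate of $X$. Let $X$ be a simple object of $\mathcal C(\mathfrak{sl}_{r+1},k)$ with $\dim(X)=\dim(\Lambda_1+\Lambda_r)$. Then either $X\in[\Lambda_1+\Lambda_r]$, or one of the following holds: - $(r,k)=(8,3)$ or $(8,15)$, and $X\in[\Lambda_3]$ or $X\in[\Lambda_3^*]=[\Lambda_6]$; - $(r,k)=(2,9)$ or $(14,9)$, and $X\in[3\Lambda_1]$ or $X\in[(3\Lambda_1)^*]=[3\Lambda_r]$; - $(r,k)=(3,6)$ or $(5,4)$, and $X\in[2\Lambda_2]$; - $(r,k)=(7,4)$ or $(7,6)$, and $X\in[\Lambda_4]$; - $(r,k)=(3,8)$ or $(5,8)$, and $X\in[4\Lambda_1]$. -/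

import Mathlib

namespace SlFusion

/-- Simple objects of `C(sl_{r+1}, k)`: formal sums `∑ i, λ_i Λ_i` over the cyclic index set
`{0, …, r}`, with natural number labels `λ_i` adding up to the level `k`. -/
@[ext]
structure SimpleObj (r k : ℕ) where
  label : Fin (r + 1) → ℕ
  sum_label : ∑ i, label i = k

/-- The root of unity `q = exp (2 π i / (2 (1 + k + r)))`. -/
noncomputable def q (r k : ℕ) : ℂ :=
  Complex.exp (2 * Real.pi * Complex.I * (1 / (2 * (1 + k + r))))

/-- The quantum integer `[n]_{r,k} = (q ^ n - q ^ (-n)) / (q - q⁻¹)`. -/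
noncomputable def quantumInt (r k : ℕ) (n : ℤ) : ℂ :=
  (q r k ^ n - q r k ^ (-n)) / (q r k - (q r k)⁻¹)

namespace SimpleObj

variable {r k : ℕ}

/-- The length of row `j` (rows are counted from `0`) of the diagram of `X`, namely
`∑_{i = j + 1}^{r} λ_i`. -/
def row (X : SimpleObj r k) (j : ℕ) : ℕ :=
  ∑ i : Fin (r + 1), if j < (i : ℕ) then X.label i else 0

theorem row_antitone (X : SimpleObj r k) : Antitone X.row := by
  intro a b hab
  unfold row
  refine Finset.sum_le_sum fun i _ => ?_
  split_ifs <;> omega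

/-- The Young diagram `T(X)`, with (at most) `r` rows and `k` columns, both counted from `0`. -/
def diagram (X : SimpleObj r k) : YoungDiagram where
  cells := (Finset.range r ×ˢ Finset.range k).filter fun c => c.2 < X.row c.1
  isLowerSet := by
    rintro ⟨a, b⟩ ⟨c, d⟩ hle h
    obtain ⟨h1, h2⟩ : c ≤ a ∧ d ≤ b := hle
    have h3 := X.row_antitone h1
    simp only [Finset.coe_filter, Finset.mem_product, Finset.mem_range, Set.mem_ofPred_eq] at h ⊢
    omega

/-- The hook length of the box `c` in row `c.1` and column `c.2` of a Young diagram: the boxes to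
its right, the boxes below it, and the box itself. -/
def hookLength (T : YoungDiagram) (c : ℕ × ℕ) : ℕ :=
  (T.rowLen c.1 - (c.2 + 1)) + (T.colLen c.2 - (c.1 + 1)) + 1

/-- The quantum dimension of a simple object, by the hook formula: the product over the boxes
`(x, y)` of `T(X)` of `[r + 1 - x + y]` divided by the quantum integer of the hook length. -/
noncomputable def dim (X : SimpleObj r k) : ℂ :=
  ∏ c ∈ X.diagram.cells,
    quantumInt r k ((r : ℤ) + 1 - c.1 + c.2) / quantumInt r k (hookLength X.diagram c)

/-- The action of the simple current `k Λ_a`, that is `∑ λ_i Λ_i ↦ ∑ λ_i Λ_{i + a}`, with indices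
modulo `r + 1`. -/
def current (a : Fin (r + 1)) (X : SimpleObj r k) : SimpleObj r k where
  label i := X.label (i - a)
  sum_label := (Equiv.sum_comp (Equiv.subRight a) X.label).trans X.sum_label

/-- Charge conjugation `∑ λ_i Λ_i ↦ ∑ λ_i Λ_{-i}`, with indices modulo `r + 1`. -/
def conj (X : SimpleObj r k) : SimpleObj r k where
  label i := X.label (-i)
  sum_label := (Equiv.sum_comp (Equiv.neg (Fin (r + 1))) X.label).trans X.sum_label

/-- The orbit `[X]` of `X` under the action of the simple currents. -/
def orbit (X : SimpleObj r k) : Set (SimpleObj r k) :=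
  Set.range fun a : Fin (r + 1) => X.current a

/-- The simple object `a Λ_b`, that is `(k - a) Λ_0 + a Λ_b`. -/
def multiple (a : ℕ) (b : Fin (r + 1)) (h : a ≤ k) : SimpleObj r k where
  label := Pi.single 0 (k - a) + Pi.single b a
  sum_label := by
    simp [Finset.sum_add_distrib, h]

/-- The simple object `Λ_1 + Λ_r`, that is `(k - 2) Λ_0 + Λ_1 + Λ_r`
(it is `(k - 2) Λ_0 + 2 Λ_1` for `r = 1`). -/
def adjoint (h : 2 ≤ k) : SimpleObj r k where
  label := Pi.single 0 (k - 2) + Pi.single 1 1 + Pi.single (Fin.last r) 1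
  sum_label := by
    simp [Finset.sum_add_distrib]
    omega

end SimpleObj

end SlFusion

namespace SlFusion

/-! Put n = r + 1 and N = n + k, so that [m] = sin(mπ/N)/sin(π/N) is real. Reading the first-column
hook lengths as beads turns the hook formula into Weyl's product of [difference of beads] over pairs
(`realDim_eq`). Rotating the labels moves the beads around a circle of length N, and [N - m] = [m],
so the dimension is constant on orbits (`realDim_current`).

The engine is [x + d][x - d] = [x]² - [d]²: the dimension is strictly log-concave along lines of
labels (`realDim_mul_lt`). Hence, between any two nonzero labels, moving a unit in one of the two
directions strictly lowers the dimension (`exists_realDim_lt`). The same concavity, in explicit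
form, holds for quantum binomials and for two-column diagrams, where an interior value exceeds the
smaller end value (`min_lt_of_logConcave`).

Three or more nonzero labels: a counterexample of least dimension admits no move that keeps three
labels nonzero, so up to rotation it is Λ_a + Λ_b with 0 < a < b. Among these the adjoint object, of
dimension [n - 1][n + 1], is minimal, with ties only inside its orbit (`three_support`). One nonzero
label: the dimension is 1, which forces N = 4.

Two nonzero labels: up to rotation X = aΛ_b. If X or its rotation (k - a)Λ_{-b} is fundamental, its
dimension is a binomial "n choose b"; for a one-row diagram it is "k choose a", and the adjoint
dimension is symmetric under n ↔ k. Equality with [n - 1][n + 1] is then settled by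
`qbinom_eq_adjoint`: trigonometric factorizations find the sporadic solutions, and polynomial
estimates in [2]² exclude the rest. In the remaining rectangles log-concavity in a and in b reduces
to 2Λ_2, whose ratio to the adjoint dimension is [n]²/([2]²[3]); equality happens only for N = 10
with n = 4 or k = 4. -/

/-- The quantum number `sin (m π / N) / sin (π / N)` for a real argument `m`. -/
noncomputable def qnum (N : ℕ) (m : ℝ) : ℝ := Real.sin (m * (Real.pi / N)) / Real.sin (Real.pi / N)

/-! ### Quantum numbers and quantum factorials -/

section qnum

variable {N : ℕ}

theorem sin_pi_div_pos (hN : 2 ≤ N) : 0 < Real.sin (Real.pi / N) := by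
  have h2 : (2 : ℝ) ≤ N := by exact_mod_cast hN
  refine Real.sin_pos_of_pos_of_lt_pi (by have := Real.pi_pos; positivity) ?_
  rw [div_lt_iff₀ (by linarith)]
  nlinarith [Real.pi_pos]

theorem mul_pi_div_self (hN : 2 ≤ N) : (N : ℝ) * (Real.pi / N) = Real.pi := by
  have h2 : (2 : ℝ) ≤ N := by exact_mod_cast hN
  field_simp

theorem pi_div_pos (hN : 2 ≤ N) : 0 < Real.pi / N := by
  have h2 : (2 : ℝ) ≤ N := by exact_mod_cast hN
  have := Real.pi_pos
  positivity

theorem qnum_pos (hN : 2 ≤ N) {m : ℝ} (h0 : 0 < m) (h1 : m < N) : 0 < qnum N m := by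
  refine div_pos (Real.sin_pos_of_pos_of_lt_pi (mul_pos h0 (pi_div_pos hN)) ?_)
    (sin_pi_div_pos hN)
  have := mul_lt_mul_of_pos_right h1 (pi_div_pos hN)
  rwa [mul_pi_div_self hN] at this

theorem qnum_zero : qnum N 0 = 0 := by simp [qnum]

theorem qnum_one (hN : 2 ≤ N) : qnum N 1 = 1 := by
  simp [qnum, (sin_pi_div_pos hN).ne']

theorem qnum_neg (m : ℝ) : qnum N (-m) = -qnum N m := by
  simp [qnum, neg_div]

theorem qnum_reflect (hN : 2 ≤ N) (m : ℝ) : qnum N (N - m) = qnum N m := by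
  rw [qnum, sub_mul, mul_pi_div_self hN, Real.sin_pi_sub, qnum]

theorem qnum_eq_of_add (hN : 2 ≤ N) {x y : ℝ} (h : x + y = N) : qnum N x = qnum N y := by
  rw [← qnum_reflect hN y, ← h, add_sub_cancel_right]

/-- The product-to-sum formula for sines; the Chebyshev recursion and the comparisons of
neighbouring products below are instances of it. -/
theorem qnum_mul_sub (x y t : ℝ) :
    qnum N (x + t) * qnum N (y + t) - qnum N x * qnum N y = qnum N t * qnum N (x + y + t) := by
  unfold qnum
  generalize Real.pi / (N : ℝ) = θ
  simp only [add_mul, Real.sin_add, Real.cos_add]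
  rw [div_mul_div_comm, div_mul_div_comm, div_mul_div_comm, ← sub_div]
  congr 1
  linear_combination Real.sin (x * θ) * Real.sin (y * θ) * Real.sin_sq_add_cos_sq (t * θ)

/-- sin(u + v) sin(u - v) = sin²u - sin²v. This is the source of all log-concavity of dimensions. -/
theorem qnum_add_mul_sub (x d : ℝ) :
    qnum N (x + d) * qnum N (x - d) = qnum N x ^ 2 - qnum N d ^ 2 := by
  unfold qnum
  generalize Real.pi / (N : ℝ) = θ
  simp only [add_mul, sub_mul, Real.sin_add, Real.sin_sub]
  rw [div_mul_div_comm, div_pow, div_pow, ← sub_div, sq (Real.sin θ)]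
  congr 1
  linear_combination Real.sin (x * θ) ^ 2 * Real.sin_sq_add_cos_sq (d * θ) -
    Real.sin (d * θ) ^ 2 * Real.sin_sq_add_cos_sq (x * θ)

theorem qnum_strictMono (hN : 2 ≤ N) {x y : ℝ} (hx : 0 ≤ x) (hxy : x < y) (h : x + y < N) :
    qnum N x < qnum N y := by
  unfold qnum
  have hθ := pi_div_pos hN
  refine div_lt_div_of_pos_right ?_ (sin_pi_div_pos hN)
  rw [← sub_pos, Real.sin_sub_sin]
  have e := mul_pi_div_self hN
  have h1 : 0 < Real.sin ((y * (Real.pi / N) - x * (Real.pi / N)) / 2) := by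
    apply Real.sin_pos_of_pos_of_lt_pi <;> nlinarith [Real.pi_pos]
  have h2 : 0 < Real.cos ((y * (Real.pi / N) + x * (Real.pi / N)) / 2) := by
    apply Real.cos_pos_of_mem_Ioo
    constructor <;> nlinarith [Real.pi_pos]
  positivity

theorem qnum_mono (hN : 2 ≤ N) {x y : ℝ} (hx : 0 ≤ x) (hxy : x ≤ y) (h : x + y ≤ N) :
    qnum N x ≤ qnum N y := by
  rcases hxy.eq_or_lt with rfl | h1
  · rfl
  rcases h.eq_or_lt with h2 | h2
  · exact (qnum_eq_of_add hN h2).le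
  · exact (qnum_strictMono hN hx h1 h2).le

/-- On [0, N] the sine takes a value only at x and N - x. This is how an equation between quantum
numbers determines N. -/
theorem qnum_injective_of_lt (hN : 2 ≤ N) {x y : ℝ} (hx : 0 ≤ x) (hxy : x < y) (hy : y ≤ N)
    (h : qnum N x = qnum N y) : x + y = N := by
  rcases lt_trichotomy (x + y) N with h1 | h1 | h1
  · exact absurd h (qnum_strictMono hN hx hxy h1).ne
  · exact h1
  · have := qnum_strictMono hN (x := N - y) (y := N - x) (by linarith) (by linarith) (by linarith)
    rw [qnum_reflect hN, qnum_reflect hN] at this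
    exact absurd h.symm this.ne

theorem qnum_mul_lt_sq {x d : ℝ} (hd : qnum N d ≠ 0) :
    qnum N (x + d) * qnum N (x - d) < qnum N x ^ 2 := by
  have : 0 < qnum N d ^ 2 := by positivity
  linarith [qnum_add_mul_sub (N := N) x d]

theorem qnum_mul_le_sq (x d : ℝ) :
    qnum N (x + d) * qnum N (x - d) ≤ qnum N x ^ 2 := by
  linarith [qnum_add_mul_sub (N := N) x d, sq_nonneg (qnum N d)]

/-- The quantum factorial `[1] [2] ⋯ [m]`. -/
noncomputable def qfact (N m : ℕ) : ℝ := ∏ i ∈ Finset.range m, qnum N ((i : ℝ) + 1)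

theorem qfact_zero : qfact N 0 = 1 := by simp [qfact]

theorem qfact_succ (m : ℕ) : qfact N (m + 1) = qfact N m * qnum N ((m : ℝ) + 1) := by
  simp [qfact, Finset.prod_range_succ]

theorem qfact_pos {m : ℕ} (h : m < N) : 0 < qfact N m := by
  refine Finset.prod_pos fun i hi => ?_
  have hi := Finset.mem_range.1 hi
  apply qnum_pos (by omega) (by positivity)
  exact_mod_cast (by omega : i + 1 < N)

/-- A descending product of quantum numbers is a quotient of quantum factorials. -/
theorem prod_desc (a b : ℕ) (hab : b ≤ a) :
    (∏ x ∈ Finset.range b, qnum N ((a : ℝ) - x)) * qfact N (a - b) = qfact N a := by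
  induction b with
  | zero => simp
  | succ b ih =>
    rw [Finset.prod_range_succ, ← ih (by omega)]
    obtain ⟨c, rfl⟩ : ∃ c, a = c + b + 1 := ⟨a - b - 1, by omega⟩
    rw [show c + b + 1 - (b + 1) = c by omega, show c + b + 1 - b = c + 1 by omega, qfact_succ]
    push_cast
    rw [show (c : ℝ) + b + 1 - b = c + 1 by ring]
    ring

theorem prod_asc (a b : ℕ) :
    (∏ y ∈ Finset.range b, qnum N ((a : ℝ) + 1 + y)) * qfact N a = qfact N (a + b) := by
  induction b with
  | zero => simp
  | succ b ih =>
    rw [Finset.prod_range_succ, ← add_assoc, qfact_succ, ← ih]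
    push_cast
    rw [show (a : ℝ) + 1 + b = a + b + 1 by ring]
    ring

/-- Reflecting i to N - i identifies [m]! with the top part of [N - 1]!. It trades rank for level in
one-row dimensions. -/
theorem qfact_reflect (hN : 2 ≤ N) {m m' : ℕ} (h : m + m' + 1 = N) :
    qfact N m * qfact N m' = qfact N (N - 1) := by
  rw [← prod_desc (N - 1) m (by omega), show N - 1 - m = m' by omega]
  congr 1
  refine Finset.prod_congr rfl fun i _ => (qnum_eq_of_add hN ?_)
  have : ((N - 1 : ℕ) : ℝ) = N - 1 := by push_cast [show 1 ≤ N by omega]; rfl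
  rw [this]; ring

end qnum

/-- Here q = exp(iπ/N) with N = r + 1 + k, and the factor 2i cancels. From here on everything is
real. -/
theorem quantumInt_eq (r k : ℕ) (n : ℤ) : quantumInt r k n = (qnum (r + 1 + k) n : ℂ) := by
  have hq : q r k = Complex.exp (((Real.pi / ((r + 1 + k : ℕ) : ℝ) : ℝ) : ℂ) * Complex.I) := by
    rw [q]; congr 1; push_cast
    have : (1 + k + r : ℂ) ≠ 0 := by
      exact_mod_cast (by omega : 1 + k + r ≠ 0)
    have h' : (r + 1 + k : ℂ) ≠ 0 := by
      exact_mod_cast (by omega : r + 1 + k ≠ 0)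
    field_simp
    ring
  rw [quantumInt, qnum, hq]
  set t : ℝ := Real.pi / ((r + 1 + k : ℕ) : ℝ)
  have e : ∀ m : ℤ, Complex.exp ((t : ℂ) * Complex.I) ^ m =
      Complex.exp (((m * t : ℝ) : ℂ) * Complex.I) := by
    intro m
    rw [← Complex.exp_int_mul]; push_cast; ring_nf
  have e1 : (Complex.exp ((t : ℂ) * Complex.I))⁻¹ = Complex.exp (((-t : ℝ) : ℂ) * Complex.I) := by
    rw [← Complex.exp_neg]; push_cast; ring_nf
  rw [e, e, e1]
  simp only [Complex.exp_mul_I, ← Complex.ofReal_cos, ← Complex.ofReal_sin, Int.cast_neg, neg_mul,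
    Real.cos_neg, Real.sin_neg]
  push_cast
  rw [show ∀ a b : ℂ, a + b * Complex.I - (a + -b * Complex.I) = 2 * Complex.I * b by intros; ring,
    show ∀ a b : ℂ, a + b * Complex.I - (a + -b * Complex.I) = 2 * Complex.I * b by intros; ring]
  rw [mul_div_mul_left _ _ (by simp)]

theorem qfact_eq_prod_Icc (N m : ℕ) : qfact N m = ∏ i ∈ Finset.Icc 1 m, qnum N (i : ℝ) := by
  induction m with
  | zero => simp [qfact_zero]
  | succ m ih => rw [qfact_succ, ih, Finset.prod_Icc_succ_top (by omega)]; push_cast; rfl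

/-! ### Beads and the Weyl dimension formula -/

namespace SimpleObj

variable {r k : ℕ}

theorem row_le (X : SimpleObj r k) (j : ℕ) : X.row j ≤ k := by
  conv_rhs => rw [← X.sum_label]
  refine Finset.sum_le_sum fun i _ => ?_
  split_ifs <;> omega

theorem row_eq_zero (X : SimpleObj r k) {j : ℕ} (h : r ≤ j) : X.row j = 0 := by
  refine Finset.sum_eq_zero fun i _ => ?_
  rw [if_neg (by omega)]

theorem mem_diagram (X : SimpleObj r k) (c : ℕ × ℕ) : c ∈ X.diagram ↔ c.2 < X.row c.1 := by
  rw [← YoungDiagram.mem_cells]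
  simp only [diagram, Finset.mem_filter, Finset.mem_product, Finset.mem_range]
  refine ⟨fun h => h.2, fun h => ⟨⟨?_, h.trans_le (X.row_le _)⟩, h⟩⟩
  by_contra h1
  rw [X.row_eq_zero (by omega)] at h
  omega

theorem rowLen_diagram (X : SimpleObj r k) (i : ℕ) : X.diagram.rowLen i = X.row i := by
  refine eq_of_forall_lt_iff fun j => ?_
  rw [← YoungDiagram.mem_iff_lt_rowLen, mem_diagram]

theorem lt_colLen_diagram (X : SimpleObj r k) (i j : ℕ) :
    i < X.diagram.colLen j ↔ j < X.row i := by
  rw [← YoungDiagram.mem_iff_lt_colLen, mem_diagram]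

theorem colLen_diagram_le (X : SimpleObj r k) (j : ℕ) : X.diagram.colLen j ≤ r := by
  by_contra h
  have := (X.lt_colLen_diagram r j).1 (by omega)
  rw [X.row_eq_zero le_rfl] at this
  omega

theorem prod_diagram (X : SimpleObj r k) {M : Type*} [CommMonoid M] (f : ℕ → ℕ → M) :
    ∏ c ∈ X.diagram.cells, f c.1 c.2 =
      ∏ i ∈ Finset.range (r + 1), ∏ j ∈ Finset.range (X.row i), f i j := by
  rw [Finset.prod_sigma']
  refine Finset.prod_bij' (fun c _ => ⟨c.1, c.2⟩) (fun c _ => (c.1, c.2)) ?_ ?_ ?_ ?_ ?_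
  · intro c hc
    have h := (X.mem_diagram c).1 ((YoungDiagram.mem_cells _).1 hc)
    simp only [Finset.mem_sigma, Finset.mem_range]
    refine ⟨?_, h⟩
    by_contra h1
    rw [X.row_eq_zero (by omega)] at h
    omega
  · intro c hc
    simp only [Finset.mem_sigma, Finset.mem_range] at hc
    exact (YoungDiagram.mem_cells _).2 ((X.mem_diagram _).2 hc.2)
  all_goals simp

/-- The first-column hook lengths of the diagram (with `r + 1` rows), which are the positions of
the beads in the abacus picture of `X`. -/
def bead (X : SimpleObj r k) (i : ℕ) : ℕ := X.row i + (r - i)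

theorem bead_lt_bead (X : SimpleObj r k) {i j : ℕ} (hij : i < j) (hj : j ≤ r) :
    X.bead j < X.bead i := by
  have := X.row_antitone hij.le
  unfold bead
  omega

theorem bead_lt (X : SimpleObj r k) (i : ℕ) : X.bead i < r + 1 + k := by
  have := X.row_le i
  unfold bead
  omega

/-- The hook lengths in row `i`, together with the differences of the bead at `i` and the later
ones, exhaust `1, …, X.bead i`. -/
theorem prod_hookLength_mul (X : SimpleObj r k) {M : Type*} [CommMonoid M] (f : ℕ → M) {i : ℕ}
    (hi : i ≤ r) :
    (∏ j ∈ Finset.range (X.row i), f (hookLength X.diagram (i, j))) *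
      ∏ j ∈ Finset.Ioc i r, f (X.bead i - X.bead j) = ∏ m ∈ Finset.Icc 1 (X.bead i), f m := by
  have hcol : ∀ y, y < X.row i → i < X.diagram.colLen y := fun y h =>
    (X.lt_colLen_diagram i y).2 h
  have hanti : ∀ y z, y ≤ z → X.diagram.colLen z ≤ X.diagram.colLen y := fun y z h =>
    X.diagram.colLen_anti y z h
  have hhook : ∀ y, hookLength X.diagram (i, y) =
      (X.row i - (y + 1)) + (X.diagram.colLen y - (i + 1)) + 1 := fun y => by
    simp [hookLength, X.rowLen_diagram]
  have hinj : Set.InjOn (fun y => hookLength X.diagram (i, y)) (Finset.range (X.row i)) := by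
    intro y hy z hz h
    simp only [Finset.coe_range, Set.mem_Iio] at hy hz
    simp only [hhook] at h
    have h1 := hcol y hy
    have h2 := hcol z hz
    rcases le_total y z with h3 | h3 <;> have h4 := hanti _ _ h3 <;> omega
  have hinj' : Set.InjOn (fun j => X.bead i - X.bead j) (Finset.Ioc i r) := by
    intro y hy z hz h
    simp only [Finset.coe_Ioc, Set.mem_Ioc] at hy hz
    have h1 := X.bead_lt_bead hy.1 hy.2
    have h2 := X.bead_lt_bead hz.1 hz.2
    simp only at h
    rcases lt_trichotomy y z with h3 | h3 | h3
    · have := X.bead_lt_bead h3 hz.2; omega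
    · exact h3
    · have := X.bead_lt_bead h3 hy.2; omega
  have hdisj : Disjoint ((Finset.range (X.row i)).image fun y => hookLength X.diagram (i, y))
      ((Finset.Ioc i r).image fun j => X.bead i - X.bead j) := by
    rw [Finset.disjoint_left]
    intro m hm hm'
    simp only [Finset.mem_image, Finset.mem_range, Finset.mem_Ioc] at hm hm'
    obtain ⟨y, hy, rfl⟩ := hm
    obtain ⟨j, hj, h⟩ := hm'
    have h1 := hcol y hy
    have h2 := X.bead_lt_bead hj.1 hj.2
    have h3 := X.lt_colLen_diagram j y
    rw [hhook] at h
    unfold bead at h h2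
    omega
  rw [← Finset.prod_image hinj, ← Finset.prod_image hinj', ← Finset.prod_union]
  · congr 1
    -- The two disjoint families lie in 1, …, `X.bead i`, and their sizes `X.row i` and r - i add up
    -- to `X.bead i`.
    refine Finset.eq_of_subset_of_card_le ?_ ?_
    · intro m hm
      simp only [Finset.mem_union, Finset.mem_image, Finset.mem_range, Finset.mem_Ioc] at hm
      rw [Finset.mem_Icc]
      rcases hm with ⟨y, hy, rfl⟩ | ⟨j, hj, rfl⟩
      · have h1 := hcol y hy
        have h2 := X.colLen_diagram_le y
        rw [hhook, bead]
        omega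
      · have h1 := X.bead_lt_bead hj.1 hj.2
        omega
    · rw [Finset.card_union_of_disjoint, Finset.card_image_of_injOn hinj,
        Finset.card_image_of_injOn hinj']
      · simp [bead]
      · exact hdisj
  · exact hdisj

/-- The product of the quantum numbers of the differences of the beads. -/
noncomputable def beadProd (X : SimpleObj r k) : ℝ :=
  ∏ i ∈ Finset.range (r + 1), ∏ j ∈ Finset.Ioc i r,
    qnum (r + 1 + k) ((X.bead i : ℝ) - X.bead j)

/-- The value of `beadProd` at the unit object. -/
noncomputable def beadDenom (r k : ℕ) : ℝ :=
  ∏ i ∈ Finset.range (r + 1), ∏ j ∈ Finset.Ioc i r, qnum (r + 1 + k) ((j : ℝ) - i)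

theorem beadDenom_pos (hk : 1 ≤ k) : 0 < beadDenom r k := by
  refine Finset.prod_pos fun i hi => Finset.prod_pos fun j hj => ?_
  simp only [Finset.mem_range, Finset.mem_Ioc] at hi hj
  have h1 : (i : ℝ) < j := by exact_mod_cast hj.1
  have h2 : (j : ℝ) < (r + 1 + k : ℕ) := by exact_mod_cast (by omega : j < r + 1 + k)
  have h3 : (0 : ℝ) ≤ i := by positivity
  exact qnum_pos (by omega) (by linarith) (by linarith)

theorem beadProd_pos (hk : 1 ≤ k) (X : SimpleObj r k) : 0 < X.beadProd := by
  refine Finset.prod_pos fun i hi => Finset.prod_pos fun j hj => ?_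
  simp only [Finset.mem_range, Finset.mem_Ioc] at hi hj
  have h1 : (X.bead j : ℝ) < X.bead i := by exact_mod_cast X.bead_lt_bead hj.1 hj.2
  have h2 : (X.bead i : ℝ) < (r + 1 + k : ℕ) := by exact_mod_cast X.bead_lt i
  have h3 : (0 : ℝ) ≤ X.bead j := by positivity
  exact qnum_pos (by omega) (by linarith) (by linarith)

/-- The quantum dimension as a real number. -/
noncomputable def realDim (X : SimpleObj r k) : ℝ :=
  ∏ i ∈ Finset.range (r + 1), ∏ j ∈ Finset.range (X.row i),
    qnum (r + 1 + k) ((r : ℝ) + 1 - i + j) / qnum (r + 1 + k) (hookLength X.diagram (i, j))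

theorem dim_eq_realDim (X : SimpleObj r k) : X.dim = (X.realDim : ℂ) := by
  rw [dim, realDim, X.prod_diagram (fun x y => quantumInt r k ((r : ℤ) + 1 - x + y) /
    quantumInt r k (hookLength X.diagram (x, y)))]
  push_cast [quantumInt_eq]
  rfl

/-- The Weyl dimension formula. -/
theorem realDim_eq (hk : 1 ≤ k) (X : SimpleObj r k) :
    X.realDim = X.beadProd / beadDenom r k := by
  rw [realDim, beadProd, beadDenom, ← Finset.prod_div_distrib]
  refine Finset.prod_congr rfl fun i hi => ?_
  have hi : i ≤ r := by simpa [Nat.lt_succ_iff] using hi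
  have hb := X.bead_lt i
  have h1 := X.prod_hookLength_mul (fun m => qnum (r + 1 + k) (m : ℝ)) hi
  rw [← qfact_eq_prod_Icc] at h1
  have h2 := prod_asc (N := r + 1 + k) (r - i) (X.row i)
  have h3 : ∏ j ∈ Finset.Ioc i r, qnum (r + 1 + k) ((j : ℝ) - i) = qfact (r + 1 + k) (r - i) := by
    rw [qfact_eq_prod_Icc]
    refine Finset.prod_bij' (fun j _ => j - i) (fun j _ => j + i) ?_ ?_ ?_ ?_ ?_
    · intro j hj; simp only [Finset.mem_Ioc, Finset.mem_Icc] at hj ⊢; omega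
    · intro j hj; simp only [Finset.mem_Ioc, Finset.mem_Icc] at hj ⊢; omega
    · intro j hj; simp only [Finset.mem_Ioc] at hj ⊢; omega
    · intro j hj; simp
    · intro j hj
      simp only [Finset.mem_Ioc] at hj
      rw [Nat.cast_sub hj.1.le]
  have h4 : ∏ j ∈ Finset.Ioc i r, qnum (r + 1 + k) (((X.bead i - X.bead j : ℕ) : ℝ)) =
      ∏ j ∈ Finset.Ioc i r, qnum (r + 1 + k) ((X.bead i : ℝ) - X.bead j) := by
    refine Finset.prod_congr rfl fun j hj => ?_
    simp only [Finset.mem_Ioc] at hj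
    rw [Nat.cast_sub (X.bead_lt_bead hj.1 hj.2).le]
  have h5 : ∏ j ∈ Finset.range (X.row i), qnum (r + 1 + k) (((r - i : ℕ) : ℝ) + 1 + j) =
      ∏ j ∈ Finset.range (X.row i), qnum (r + 1 + k) ((r : ℝ) + 1 - i + j) := by
    refine Finset.prod_congr rfl fun j hj => ?_
    rw [Nat.cast_sub hi]; congr 1; ring
  rw [h4] at h1
  rw [h5, show r - i + X.row i = X.bead i by unfold bead; omega] at h2
  rw [Finset.prod_div_distrib, h3]
  have p1 : 0 < qfact (r + 1 + k) (X.bead i) := qfact_pos hb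
  have p2 : 0 < qfact (r + 1 + k) (r - i) := qfact_pos (by omega)
  -- With B the bead of row i, the numerators multiply to [B]!/[r - i]! and the hooks to [B]!
  -- divided by the product over bead differences; [B]! cancels.
  rw [div_eq_div_iff (fun h => by rw [h, zero_mul] at h1; exact p1.ne h1) p2.ne', h2, mul_comm, h1]

theorem realDim_pos (hk : 1 ≤ k) (X : SimpleObj r k) : 0 < X.realDim := by
  rw [realDim_eq hk]
  exact div_pos (beadProd_pos hk X) (beadDenom_pos hk)

theorem row_eq_row_succ_add (X : SimpleObj r k) {i : ℕ} (hi : i < r) :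
    X.row i = X.row (i + 1) + X.label ⟨i + 1, by omega⟩ := by
  have h : X.label ⟨i + 1, by omega⟩ =
      ∑ m : Fin (r + 1), if m = ⟨i + 1, by omega⟩ then X.label m else 0 := by simp
  rw [h, row, row, ← Finset.sum_add_distrib]
  refine Finset.sum_congr rfl fun m _ => ?_
  simp only [Fin.ext_iff]
  split_ifs <;> omega

theorem row_zero_add (X : SimpleObj r k) : X.row 0 + X.label 0 = k := by
  have h : X.label 0 = ∑ m : Fin (r + 1), if m = 0 then X.label m else 0 := by simp
  conv_rhs => rw [← X.sum_label]
  rw [h, row, ← Finset.sum_add_distrib]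
  refine Finset.sum_congr rfl fun m _ => ?_
  simp only [Fin.ext_iff, Fin.val_zero]
  split_ifs <;> omega

theorem ext_of_row (X Y : SimpleObj r k) (h : ∀ i < r, X.row i = Y.row i) : X = Y := by
  have h' : ∀ i, X.row i = Y.row i := fun i => by
    by_cases hi : i < r
    · exact h i hi
    · rw [X.row_eq_zero (by omega), Y.row_eq_zero (by omega)]
  ext ⟨i, hi⟩
  rcases i with _ | i
  · have h1 := X.row_zero_add
    have h2 := Y.row_zero_add
    rw [h' 0] at h1
    change X.label 0 = Y.label 0
    omega
  · have h1 := X.row_eq_row_succ_add (i := i) (by omega)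
    have h2 := Y.row_eq_row_succ_add (i := i) (by omega)
    rw [h', h'] at h1
    omega

theorem ext_of_bead (X Y : SimpleObj r k)
    (h : ∀ i j, i < j → j ≤ r → (X.bead i : ℝ) - X.bead j = Y.bead i - Y.bead j) : X = Y := by
  refine X.ext_of_row Y fun i hi => ?_
  have h1 := h i r hi le_rfl
  have e : ∀ Z : SimpleObj r k, Z.bead r = 0 := fun Z => by simp [bead, Z.row_eq_zero le_rfl]
  rw [e, e] at h1
  have h2 : X.bead i = Y.bead i := by simpa using h1
  simpa [bead] using h2

/-! ### Log-concavity in the labels -/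

/-- Strict logarithmic concavity of the quantum dimension along lines of labels. -/
theorem realDim_mul_lt (hk : 1 ≤ k) (X Y Z : SimpleObj r k)
    (h : ∀ i, Y.label i + Z.label i = 2 * X.label i) (hne : Y ≠ X) :
    Y.realDim * Z.realDim < X.realDim ^ 2 := by
  have hrow : ∀ j, Y.row j + Z.row j = 2 * X.row j := fun j => by
    rw [row, row, row, ← Finset.sum_add_distrib, Finset.mul_sum]
    refine Finset.sum_congr rfl fun i _ => ?_
    have := h i
    split_ifs <;> omega
  have hbead : ∀ j, (Z.bead j : ℝ) = 2 * X.bead j - Y.bead j := fun j => by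
    have h1 := hrow j
    have h2 : Y.bead j + Z.bead j = 2 * X.bead j := by unfold bead; omega
    have h3 : (Y.bead j : ℝ) + Z.bead j = 2 * X.bead j := by exact_mod_cast h2
    linarith
  rw [realDim_eq hk, realDim_eq hk, realDim_eq hk, div_pow, div_mul_div_comm, ← sq]
  have hD := beadDenom_pos (r := r) hk
  refine div_lt_div_of_pos_right ?_ (by positivity)
  simp only [beadProd]
  rw [Finset.prod_sigma', Finset.prod_sigma', Finset.prod_sigma', ← Finset.prod_mul_distrib,
    ← Finset.prod_pow]
  have hpos : ∀ (W : SimpleObj r k) (i j : ℕ), i < j → j ≤ r →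
      0 < (W.bead i : ℝ) - W.bead j ∧ (W.bead i : ℝ) - W.bead j < (r + 1 + k : ℕ) := by
    intro W i j hij hj
    have h1 : (W.bead j : ℝ) < W.bead i := by exact_mod_cast W.bead_lt_bead hij hj
    have h2 : (W.bead i : ℝ) < (r + 1 + k : ℕ) := by exact_mod_cast W.bead_lt i
    have h3 : (0 : ℝ) ≤ W.bead j := by positivity
    constructor <;> linarith
  have hmem : ∀ c : (_ : ℕ) × ℕ,
      c ∈ (Finset.range (r + 1)).sigma (fun i => Finset.Ioc i r) ↔ c.1 < c.2 ∧ c.2 ≤ r := by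
    intro c; simp only [Finset.mem_sigma, Finset.mem_range, Finset.mem_Ioc]; omega
  have e1 : ∀ i j : ℕ, (Y.bead i : ℝ) - Y.bead j = ((X.bead i : ℝ) - X.bead j) +
      (((Y.bead i : ℝ) - Y.bead j) - ((X.bead i : ℝ) - X.bead j)) := by intros; ring
  have e2 : ∀ i j : ℕ, (Z.bead i : ℝ) - Z.bead j = ((X.bead i : ℝ) - X.bead j) -
      (((Y.bead i : ℝ) - Y.bead j) - ((X.bead i : ℝ) - X.bead j)) := by
    intro i j; rw [hbead, hbead]; ring
  refine Finset.prod_lt_prod ?_ ?_ ?_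
  · intro c hc
    rw [hmem] at hc
    have h1 := hpos Y _ _ hc.1 hc.2
    have h2 := hpos Z _ _ hc.1 hc.2
    exact mul_pos (qnum_pos (by omega) h1.1 h1.2) (qnum_pos (by omega) h2.1 h2.2)
  · intro c hc
    have := qnum_mul_le_sq (N := r + 1 + k) ((X.bead c.1 : ℝ) - X.bead c.2)
      (((Y.bead c.1 : ℝ) - Y.bead c.2) - ((X.bead c.1 : ℝ) - X.bead c.2))
    rwa [← e1, ← e2] at this
  -- Without a strict factor all bead differences of Y and X agree, because [d] ≠ 0 for 0 < |d| < N;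
  -- then Y = X.
  · by_contra hcon
    push Not at hcon
    refine hne (ext_of_bead Y X fun i j hij hj => ?_)
    have h0 := hcon ⟨i, j⟩ ((hmem _).2 ⟨hij, hj⟩)
    by_contra hd
    refine absurd h0 (not_le.2 ?_)
    simp only
    have h4 := qnum_mul_lt_sq (N := r + 1 + k) (x := (X.bead i : ℝ) - X.bead j)
      (d := ((Y.bead i : ℝ) - Y.bead j) - ((X.bead i : ℝ) - X.bead j)) ?_
    · rwa [← e1, ← e2] at h4
    have h1 := hpos Y _ _ hij hj
    have h2 := hpos X _ _ hij hj
    rcases lt_or_gt_of_ne hd with h3 | h3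
    · rw [← neg_ne_zero, ← qnum_neg]
      exact (qnum_pos (by omega) (by linarith) (by linarith)).ne'
    · exact (qnum_pos (by omega) (by linarith) (by linarith)).ne'

/-! ### Invariance under simple currents -/

theorem row_current_one_succ (X : SimpleObj (r + 1) k) {j : ℕ} (hj : j < r + 1) :
    (X.current 1).row (j + 1) + X.label (Fin.last _) = X.row j := by
  have hlab : ∀ j (hj : j < r + 1), (X.current 1).label ⟨j + 1, by omega⟩ = X.label ⟨j, by omega⟩ := by
    intro j hj
    simp only [current]
    congr 1
    rw [sub_eq_iff_eq_add]
    ext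
    rw [Fin.val_add, Fin.val_one]
    exact (Nat.mod_eq_of_lt (by omega)).symm
  induction j with
  | zero =>
    have h1 := (X.current 1).row_zero_add
    have h2 := X.row_zero_add
    have h3 := (X.current 1).row_eq_row_succ_add (i := 0) (by omega)
    rw [hlab 0 (by omega)] at h3
    have h4 : (X.current 1).label 0 = X.label (Fin.last _) := by
      simp only [current]
      congr 1
      rw [sub_eq_iff_eq_add]
      simp
    have h5 : X.label ⟨0, by omega⟩ = X.label 0 := rfl
    omega
  | succ j ih =>
    have h1 := ih (by omega) hlab
    have h2 := X.row_eq_row_succ_add (i := j) (by omega)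
    have h3 := (X.current 1).row_eq_row_succ_add (i := j + 1) (by omega)
    rw [hlab (j + 1) (by omega)] at h3
    linarith

theorem row_current_one_zero (X : SimpleObj (r + 1) k) :
    (X.current 1).row 0 + X.label (Fin.last _) = k := by
  have h1 := (X.current 1).row_zero_add
  have h4 : (X.current 1).label 0 = X.label (Fin.last _) := by
    simp only [current]
    congr 1
    rw [sub_eq_iff_eq_add]
    simp
  omega

/-- All beads move down by c + 1 modulo N, and the last one, at 0, wraps around to become the first,
at N - c - 1. Differences between unwrapped beads are kept; those with the wrapped bead turn from m
into N - m. -/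
theorem beadProd_current_one (X : SimpleObj (r + 1) k) :
    (X.current 1).beadProd = X.beadProd := by
  set Y := X.current 1
  set c := X.label (Fin.last _)
  have hb : ∀ j < r + 1, (Y.bead (j + 1) : ℝ) = X.bead j - c - 1 := fun j hj => by
    have := X.row_current_one_succ hj
    have h : Y.bead (j + 1) + c + 1 = X.bead j := by simp only [bead, Y, c]; omega
    rw [← h]; push_cast; ring
  have hb0 : (Y.bead 0 : ℝ) = (r + 1 + 1 + k : ℕ) - c - 1 := by
    have := X.row_current_one_zero
    have h : Y.bead 0 + c + 1 = r + 1 + 1 + k := by simp only [bead, Y, c]; omega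
    rw [← h]; push_cast; ring
  have hbl : X.bead (r + 1) = 0 := by simp [bead, X.row_eq_zero le_rfl]
  have shift : ∀ (i : ℕ) (f : ℕ → ℝ),
      ∏ j ∈ Finset.Ioc (i + 1) (r + 1), f j = ∏ j ∈ Finset.Ioc i r, f (j + 1) := by
    intro i f
    rw [← Finset.prod_image (g := fun j => j + 1) (f := f) (by intro a _ b _ h; simpa using h)]
    congr 1
    simp
  rw [beadProd, beadProd, Finset.prod_range_succ', Finset.prod_range_succ (n := r + 1)]
  simp only [Finset.Ioc_self, Finset.prod_empty, mul_one]
  have h0 : ∏ j ∈ Finset.Ioc 0 (r + 1), qnum (r + 1 + 1 + k) ((Y.bead 0 : ℝ) - Y.bead j) =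
      ∏ i ∈ Finset.range (r + 1), qnum (r + 1 + 1 + k) ((X.bead i : ℝ) - X.bead (r + 1)) := by
    have e : Finset.Ioc 0 (r + 1) = (Finset.range (r + 1)).image (fun j => j + 1) := by
      ext x; simp only [Finset.mem_Ioc, Finset.mem_image, Finset.mem_range]
      exact ⟨fun h => ⟨x - 1, by omega, by omega⟩, by rintro ⟨a, h, rfl⟩; omega⟩
    rw [e, Finset.prod_image (by intro a _ b _ h; simpa using h)]
    refine Finset.prod_congr rfl fun j hj => ?_
    rw [hb j (Finset.mem_range.1 hj), hb0, hbl]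
    refine qnum_eq_of_add (by omega) ?_
    push_cast; ring
  rw [h0, ← Finset.prod_mul_distrib]
  refine Finset.prod_congr rfl fun i hi => ?_
  have hi := Finset.mem_range.1 hi
  rw [shift, Finset.prod_Ioc_succ_top (by omega)]
  congr 1
  refine Finset.prod_congr rfl fun j hj => ?_
  rw [Finset.mem_Ioc] at hj
  rw [hb i hi, hb j (by omega)]
  congr 1; ring

theorem current_zero (X : SimpleObj r k) : X.current 0 = X := by
  ext i; simp [current]

theorem current_current (X : SimpleObj r k) (a b : Fin (r + 1)) :
    (X.current a).current b = X.current (a + b) := by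
  ext i
  simp only [current]
  congr 1
  abel

theorem realDim_current (hk : 1 ≤ k) (X : SimpleObj r k) (a : Fin (r + 1)) :
    (X.current a).realDim = X.realDim := by
  rcases r with _ | r
  · rw [show a = 0 from Fin.ext (by simp), current_zero]
  induction a using Fin.induction with
  | zero => rw [current_zero]
  | succ i ih =>
    have h : i.succ = i.castSucc + 1 := by simp
    rw [h, ← current_current, realDim_eq hk, beadProd_current_one, ← realDim_eq hk, ih]

theorem mem_orbit_of_current (X Y : SimpleObj r k) (a : Fin (r + 1))
    (h : X.current a ∈ Y.orbit) : X ∈ Y.orbit := by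
  obtain ⟨b, hb⟩ := h
  refine ⟨b - a, ?_⟩
  have := congrArg (fun Z => Z.current (-a)) hb
  simp only [current_current] at this
  rw [add_neg_cancel, current_zero, ← sub_eq_add_neg] at this
  exact this

theorem self_mem_orbit (X : SimpleObj r k) : X ∈ X.orbit := ⟨0, X.current_zero⟩

theorem realDim_eq_of_mem_orbit (hk : 1 ≤ k) {X Y : SimpleObj r k} (h : X ∈ Y.orbit) :
    X.realDim = Y.realDim := by
  obtain ⟨a, rfl⟩ := h
  exact realDim_current hk Y a

end SimpleObj

theorem prod_range_ite_lt {M : Type*} [CommMonoid M] (f : ℕ → M) {b m : ℕ} (h : b ≤ m) :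
    ∏ i ∈ Finset.range m, (if i < b then f i else 1) = ∏ i ∈ Finset.range b, f i := by
  rw [← Finset.prod_filter]
  congr 1
  ext i
  simp only [Finset.mem_filter, Finset.mem_range]
  omega

/-! ### Closed forms: quantum binomials and two-column dimensions -/

/-- The quantum binomial coefficient. -/
noncomputable def qbinom (N n b : ℕ) : ℝ := qfact N n / (qfact N b * qfact N (n - b))

/-- The quantum dimension attached to a Young diagram with columns of lengths `b ≥ a`. -/
noncomputable def twoColDim (N n a b : ℕ) : ℝ :=
  qfact N n * qfact N (n + 1) * qnum N ((b : ℝ) - a + 1) /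
    (qfact N (n - b) * qfact N (b + 1) * qfact N a * qfact N (n + 1 - a))

section dims

variable {N : ℕ}

theorem twoColDim_zero {n b : ℕ} (hb : b + 1 < N) (hn : n + 1 < N) :
    twoColDim N n 0 b = qbinom N n b := by
  have p1 : 0 < qfact N (n + 1) := qfact_pos hn
  have p2 : 0 < qfact N (n - b) := qfact_pos (by omega)
  have p3 : 0 < qfact N (b + 1) := qfact_pos hb
  rw [qfact_succ] at p3
  have p4 : 0 < qfact N b := qfact_pos (by omega)
  have p5 := (pos_iff_pos_of_mul_pos p3).1 p4
  rw [twoColDim, qbinom, qfact_succ b, qfact_zero, Nat.sub_zero]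
  simp only [Nat.cast_zero, sub_zero]
  field_simp

/-- Charge conjugation: each column is replaced by its complement in a column of height n. -/
theorem twoColDim_symm {n a b : ℕ} (hab : a ≤ b) (hb : b ≤ n) :
    twoColDim N n (n - b) (n - a) = twoColDim N n a b := by
  rw [twoColDim, twoColDim, Nat.cast_sub hb, Nat.cast_sub (hab.trans hb),
    show n - (n - a) = a by omega, show n - a + 1 = n + 1 - a by omega,
    show n + 1 - (n - b) = b + 1 by omega]
  congr 1
  · congr 2; ring
  · ring

theorem qbinom_symm {n b : ℕ} (hb : b ≤ n) : qbinom N n (n - b) = qbinom N n b := by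
  rw [qbinom, qbinom, show n - (n - b) = b by omega, mul_comm (qfact N (n - b))]

theorem qbinom_pos {n b : ℕ} (hn : n < N) (hb : b ≤ n) : 0 < qbinom N n b :=
  div_pos (qfact_pos hn) (mul_pos (qfact_pos (by omega)) (qfact_pos (by omega)))

theorem twoColDim_pos {n a b : ℕ} (hn : n + 1 < N) (hab : a ≤ b) (hb : b ≤ n) :
    0 < twoColDim N n a b := by
  have h1 : (a : ℝ) ≤ b := by exact_mod_cast hab
  have h2 : (b : ℝ) + 1 < N := by exact_mod_cast (by omega : b + 1 < N)
  have h3 : (0 : ℝ) ≤ a := by positivity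
  exact div_pos (mul_pos (mul_pos (qfact_pos (by omega)) (qfact_pos hn))
    (qnum_pos (by omega) (by linarith) (by linarith)))
    (mul_pos (mul_pos (mul_pos (qfact_pos (by omega)) (qfact_pos (by omega)))
    (qfact_pos (by omega))) (qfact_pos (by omega)))

theorem qbinom_zero {n : ℕ} (hn : n < N) : qbinom N n 0 = 1 := by
  rw [qbinom, qfact_zero, one_mul, Nat.sub_zero, div_self (qfact_pos hn).ne']

theorem qbinom_succ {n b : ℕ} (hn : n < N) (hb : b < n) :
    qbinom N n (b + 1) * qnum N ((b : ℝ) + 1) = qbinom N n b * qnum N ((n : ℝ) - b) := by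
  obtain ⟨c, rfl⟩ : ∃ c, n = b + c + 1 := ⟨n - b - 1, by omega⟩
  rw [qbinom, qbinom, show b + c + 1 - (b + 1) = c by omega, show b + c + 1 - b = c + 1 by omega,
    qfact_succ b, qfact_succ c]
  have p1 : 0 < qfact N (b + 1) := qfact_pos (by omega)
  have p2 : 0 < qfact N (c + 1) := qfact_pos (by omega)
  rw [qfact_succ] at p1 p2
  have p3 : 0 < qfact N b := qfact_pos (by omega)
  have p4 : 0 < qfact N c := qfact_pos (by omega)
  have p5 := (pos_iff_pos_of_mul_pos p1).1 p3
  have p6 := (pos_iff_pos_of_mul_pos p2).1 p4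
  push_cast
  rw [show (b : ℝ) + c + 1 - b = c + 1 by ring]
  field_simp

theorem twoColDim_succ_right {n a b : ℕ} (hn : n + 1 < N) (hab : a ≤ b) (hb : b < n) :
    twoColDim N n a (b + 1) * (qnum N ((b : ℝ) + 2) * qnum N ((b : ℝ) - a + 1)) =
      twoColDim N n a b * (qnum N ((n : ℝ) - b) * qnum N ((b : ℝ) - a + 2)) := by
  obtain ⟨c, rfl⟩ : ∃ c, n = b + c + 1 := ⟨n - b - 1, by omega⟩
  rw [twoColDim, twoColDim, show b + c + 1 - (b + 1) = c by omega,
    show b + c + 1 - b = c + 1 by omega, qfact_succ (b + 1), qfact_succ c]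
  have p1 : 0 < qfact N (b + 1 + 1) := qfact_pos (by omega)
  have p2 : 0 < qfact N (c + 1) := qfact_pos (by omega)
  rw [qfact_succ] at p1 p2
  have p3 : 0 < qfact N (b + 1) := qfact_pos (by omega)
  have p4 : 0 < qfact N c := qfact_pos (by omega)
  have p5 := (pos_iff_pos_of_mul_pos p1).1 p3
  have p6 := (pos_iff_pos_of_mul_pos p2).1 p4
  have p7 : 0 < qfact N a := qfact_pos (by omega)
  have p8 : 0 < qfact N (b + c + 1 + 1 - a) := qfact_pos (by omega)
  push_cast at p5 ⊢
  rw [show (b : ℝ) + c + 1 - b = c + 1 by ring, show (b : ℝ) + 1 - a + 1 = b - a + 2 by ring]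
  rw [show (b : ℝ) + 1 + 1 = b + 2 by ring] at p5 ⊢
  field_simp

theorem twoColDim_succ_left {n a b : ℕ} (hn : n + 1 < N) (hab : a < b) (hb : b ≤ n) :
    twoColDim N n (a + 1) b * (qnum N ((a : ℝ) + 1) * qnum N ((b : ℝ) - a + 1)) =
      twoColDim N n a b * (qnum N ((n : ℝ) + 1 - a) * qnum N ((b : ℝ) - a)) := by
  obtain ⟨c, rfl⟩ : ∃ c, n = a + c + 1 := ⟨n - a - 1, by omega⟩
  rw [twoColDim, twoColDim, show a + c + 1 + 1 - (a + 1) = c + 1 by omega,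
    show a + c + 1 + 1 - a = c + 1 + 1 by omega, qfact_succ a, qfact_succ (c + 1)]
  have p1 : 0 < qfact N (a + 1) := qfact_pos (by omega)
  have p2 : 0 < qfact N (c + 1 + 1) := qfact_pos (by omega)
  rw [qfact_succ] at p1 p2
  have p3 : 0 < qfact N a := qfact_pos (by omega)
  have p4 : 0 < qfact N (c + 1) := qfact_pos (by omega)
  have p5 := (pos_iff_pos_of_mul_pos p1).1 p3
  have p6 := (pos_iff_pos_of_mul_pos p2).1 p4
  have p7 : 0 < qfact N (b + 1) := qfact_pos (by omega)
  have p8 : 0 < qfact N (a + c + 1 - b) := qfact_pos (by omega)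
  push_cast at p6 ⊢
  rw [show (a : ℝ) + c + 1 + 1 - a = c + 1 + 1 by ring, show (b : ℝ) - (a + 1) + 1 = b - a by ring]
  field_simp

theorem twoColDim_succ_succ {n a b : ℕ} (hn : n + 1 < N) (hab : a ≤ b) (hb : b < n) :
    twoColDim N n (a + 1) (b + 1) * (qnum N ((b : ℝ) + 2) * qnum N ((a : ℝ) + 1)) =
      twoColDim N n a b * (qnum N ((n : ℝ) - b) * qnum N ((n : ℝ) + 1 - a)) := by
  have h1 := twoColDim_succ_right hn hab hb
  -- The path goes through the columns (a, b + 1), since (a + 1, b) is not a diagram when a = b.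
  have h2 := twoColDim_succ_left hn (show a < b + 1 by omega) hb
  have h3 : (a : ℝ) ≤ b := by exact_mod_cast hab
  have h4 : (b : ℝ) + 2 < N + 1 := by exact_mod_cast (by omega : b + 2 < N + 1)
  have h5 : (0 : ℝ) ≤ a := by positivity
  have p1 : 0 < qnum N ((b : ℝ) - a + 1) := qnum_pos (by omega) (by linarith) (by linarith)
  have p2 : 0 < qnum N ((b : ℝ) - a + 2) := by
    rcases Nat.eq_zero_or_pos a with rfl | h
    · have h6 : (b : ℝ) + 2 < N := by exact_mod_cast (by omega : b + 2 < N)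
      exact qnum_pos (by omega) (by linarith) (by push_cast; linarith)
    · have h6 : (1 : ℝ) ≤ a := by exact_mod_cast h
      exact qnum_pos (by omega) (by linarith) (by linarith)
  push_cast at h2
  rw [show (b : ℝ) + 1 - a + 1 = b - a + 2 by ring, show (b : ℝ) + 1 - a = b - a + 1 by ring] at h2
  refine mul_right_cancel₀ (mul_pos p1 p2).ne' ?_
  linear_combination qnum N ((b : ℝ) + 2) * qnum N ((b : ℝ) - a + 1) * h2 +
    qnum N ((n : ℝ) + 1 - a) * qnum N ((b : ℝ) - a + 1) * h1

/-- Log-concavity means that the successive ratios d0/c0 and d1/c1 decrease. -/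
theorem mul_lt_sq_of_ratio {f0 f1 f2 c0 d0 c1 d1 : ℝ} (h1 : 0 < f1) (hd0 : 0 < d0) (hc1 : 0 < c1)
    (e0 : f1 * c0 = f0 * d0) (e1 : f2 * c1 = f1 * d1) (h : d1 * c0 < d0 * c1) :
    f0 * f2 < f1 ^ 2 := by
  have : f0 * f2 * (d0 * c1) = f1 ^ 2 * (d1 * c0) := by
    linear_combination (-(f2 * c1)) * e0 + f1 * c0 * e1
  have h2 : f0 * f2 * (d0 * c1) < f1 ^ 2 * (d0 * c1) := by
    rw [this]; exact mul_lt_mul_of_pos_left h (by positivity)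
  exact lt_of_mul_lt_mul_right h2 (by positivity)

/-- A strictly log-concave sequence exceeds the smaller of its end values in between. -/
theorem min_lt_of_logConcave {f : ℕ → ℝ} {lo hi m : ℕ} (hpos : ∀ t, lo ≤ t → t ≤ hi → 0 < f t)
    (hf : ∀ t, lo < t → t < hi → f (t - 1) * f (t + 1) < f t ^ 2) (h1 : lo < m) (h2 : m < hi) :
    min (f lo) (f hi) < f m := by
  by_contra hcon
  rw [not_lt, le_min_iff] at hcon
  obtain ⟨t, ht, hmin⟩ := Finset.exists_min_image (Finset.Ioo lo hi) f ⟨m, by simp [h1, h2]⟩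
  have hm := hmin m (by simp [h1, h2])
  rw [Finset.mem_Ioo] at ht
  have hall : ∀ s, lo ≤ s → s ≤ hi → f t ≤ f s := by
    intro s hs1 hs2
    rcases hs1.eq_or_lt with rfl | hs1
    · exact hm.trans hcon.1
    rcases hs2.eq_or_lt with rfl | hs2
    · exact hm.trans hcon.2
    exact hmin s (by simp [hs1, hs2])
  have := hf t ht.1 ht.2
  have hp := hpos t ht.1.le ht.2.le
  have := mul_le_mul (hall (t - 1) (by omega) (by omega)) (hall (t + 1) (by omega) (by omega))
    hp.le (hp.le.trans (hall (t - 1) (by omega) (by omega)))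
  nlinarith

/-- `[x] [y] < [x + 1] [y + 1]` when `x + y + 1 < N`. -/
theorem qnum_mul_lt_succ_mul_succ (hN : 2 ≤ N) {x y : ℝ} (h0 : 0 < x + y + 1)
    (h1 : x + y + 1 < N) : qnum N x * qnum N y < qnum N (x + 1) * qnum N (y + 1) := by
  have := qnum_mul_sub (N := N) x y 1
  have := qnum_pos hN h0 h1
  rw [qnum_one hN] at *
  linarith

/-- The successive ratios are [n - b]/[b + 1]; cross-multiplied ratios differ by exactly [n + 1],
positive because n + 1 < N. -/
theorem qbinom_logConcave {n b : ℕ} (hn : n + 1 < N) (hb0 : 0 < b) (hb : b < n) :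
    qbinom N n (b - 1) * qbinom N n (b + 1) < qbinom N n b ^ 2 := by
  obtain ⟨b, rfl⟩ : ∃ c, b = c + 1 := ⟨b - 1, by omega⟩
  have e0 := qbinom_succ (N := N) (by omega) (show b < n by omega)
  have e1 := qbinom_succ (N := N) (by omega) hb
  have h2 : (b : ℝ) + 1 + 1 ≤ n := by exact_mod_cast hb
  have h3 : (n : ℝ) + 1 < N := by exact_mod_cast hn
  have h4 : (0 : ℝ) ≤ b := by positivity
  push_cast at e1
  refine mul_lt_sq_of_ratio (qbinom_pos (by omega) hb.le)
    (qnum_pos (by omega) (by linarith) (by linarith))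
    (qnum_pos (by omega) (by linarith) (by linarith)) e0 e1 ?_
  have := qnum_mul_lt_succ_mul_succ (N := N) (by omega) (x := (n : ℝ) - (b + 1)) (y := (b : ℝ) + 1)
    (by linarith) (by linarith)
  rwa [show (n : ℝ) - (b + 1) + 1 = n - b by ring] at this

/-- The ratio of neighbours splits into a binomial-like part, whose decrease again costs [n + 2] >
0, and a part in b - a governed by [x + 1][x - 1] < [x]². -/
theorem twoColDim_logConcave_left {n a b : ℕ} (hn : n + 2 < N) (ha : 0 < a) (hab : a < b)
    (hb : b ≤ n) :
    twoColDim N n (a - 1) b * twoColDim N n (a + 1) b < twoColDim N n a b ^ 2 := by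
  obtain ⟨a, rfl⟩ : ∃ c, a = c + 1 := ⟨a - 1, by omega⟩
  have e0 := twoColDim_succ_left (N := N) (n := n) (by omega) (show a < b by omega) hb
  have e1 := twoColDim_succ_left (N := N) (n := n) (by omega) hab hb
  have h1 : (a : ℝ) + 1 + 1 ≤ b := by exact_mod_cast hab
  have h2 : (b : ℝ) ≤ n := by exact_mod_cast hb
  have h3 : (n : ℝ) + 2 < N := by exact_mod_cast hn
  have h4 : (0 : ℝ) ≤ a := by positivity
  have hN : 2 ≤ N := by omega
  push_cast at e1
  rw [show (b : ℝ) - (a + 1) + 1 = b - a by ring] at e1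
  have q1 : 0 < qnum N ((n : ℝ) + 1 - a) := qnum_pos hN (by linarith) (by linarith)
  have q2 : 0 < qnum N ((b : ℝ) - a) := qnum_pos hN (by linarith) (by linarith)
  have q3 : 0 < qnum N ((a : ℝ) + 1 + 1) := qnum_pos hN (by linarith) (by linarith)
  have q4 : 0 < qnum N ((n : ℝ) + 1 - (a + 1)) := qnum_pos hN (by linarith) (by linarith)
  have q5 : 0 < qnum N ((a : ℝ) + 1) := qnum_pos hN (by linarith) (by linarith)
  have q6 : 0 < qnum N ((b : ℝ) - (a + 1)) := qnum_pos hN (by linarith) (by linarith)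
  have q7 : 0 < qnum N ((b : ℝ) - a + 1) := qnum_pos hN (by linarith) (by linarith)
  refine mul_lt_sq_of_ratio (twoColDim_pos (by omega) hab.le hb) (mul_pos q1 q2) (mul_pos q3 q2)
    e0 e1 ?_
  have i1 := qnum_mul_lt_succ_mul_succ hN (x := (n : ℝ) + 1 - (a + 1)) (y := (a : ℝ) + 1)
    (by linarith) (by linarith)
  have i2 := qnum_mul_lt_sq (N := N) (x := (b : ℝ) - a) (d := 1) (by rw [qnum_one hN]; simp)
  rw [show (n : ℝ) + 1 - (a + 1) + 1 = n + 1 - a by ring] at i1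
  rw [show (b : ℝ) - a - 1 = b - (a + 1) by ring] at i2
  have := mul_lt_mul'' i1 i2 (by positivity) (by positivity)
  linarith

theorem twoColDim_logConcave_right {n a b : ℕ} (hn : n + 2 < N) (hab : a < b) (hb : b < n) :
    twoColDim N n a (b - 1) * twoColDim N n a (b + 1) < twoColDim N n a b ^ 2 := by
  obtain ⟨b, rfl⟩ : ∃ c, b = c + 1 := ⟨b - 1, by omega⟩
  have e0 := twoColDim_succ_right (N := N) (n := n) (by omega) (show a ≤ b by omega) (by omega)
  have e1 := twoColDim_succ_right (N := N) (n := n) (by omega) hab.le hb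
  have h1 : (b : ℝ) + 1 + 1 ≤ n := by exact_mod_cast hb
  have h2 : (a : ℝ) ≤ b := by exact_mod_cast (by omega : a ≤ b)
  have h3 : (n : ℝ) + 2 < N := by exact_mod_cast hn
  have h4 : (0 : ℝ) ≤ a := by positivity
  have hN : 2 ≤ N := by omega
  push_cast at e1
  rw [show (b : ℝ) + 1 - a + 1 = b - a + 1 + 1 by ring,
    show (b : ℝ) + 1 - a + 2 = b - a + 1 + 1 + 1 by ring] at e1
  rw [show (b : ℝ) - a + 2 = b - a + 1 + 1 by ring] at e0
  have q1 : 0 < qnum N ((n : ℝ) - b) := qnum_pos hN (by linarith) (by linarith)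
  have q2 : 0 < qnum N ((b : ℝ) - a + 1 + 1) := qnum_pos hN (by linarith) (by linarith)
  have q3 : 0 < qnum N ((b : ℝ) + 1 + 2) := qnum_pos hN (by linarith) (by linarith)
  have q4 : 0 < qnum N ((n : ℝ) - (b + 1)) := qnum_pos hN (by linarith) (by linarith)
  have q5 : 0 < qnum N ((b : ℝ) + 2) := qnum_pos hN (by linarith) (by linarith)
  have q6 : 0 < qnum N ((b : ℝ) - a + 1) := qnum_pos hN (by linarith) (by linarith)
  have q7 : 0 < qnum N ((b : ℝ) - a + 1 + 1 + 1) := qnum_pos hN (by linarith) (by linarith)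
  refine mul_lt_sq_of_ratio (twoColDim_pos (by omega) hab.le hb.le) (mul_pos q1 q2)
    (mul_pos q3 q2) e0 e1 ?_
  have i1 := qnum_mul_lt_succ_mul_succ hN (x := (n : ℝ) - (b + 1)) (y := (b : ℝ) + 2)
    (by linarith) (by linarith)
  have i2 := qnum_mul_lt_sq (N := N) (x := (b : ℝ) - a + 1 + 1) (d := 1)
    (by rw [qnum_one hN]; simp)
  rw [show (n : ℝ) - (b + 1) + 1 = n - b by ring,
    show (b : ℝ) + 2 + 1 = b + 1 + 2 by ring] at i1
  rw [show (b : ℝ) - a + 1 + 1 - 1 = b - a + 1 by ring] at i2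
  have := mul_lt_mul'' i1 i2 (by positivity) (by positivity)
  linarith

theorem twoColDim_logConcave_diag {n a b : ℕ} (hn : n + 2 < N) (ha : 0 < a) (hab : a ≤ b)
    (hb : b < n) :
    twoColDim N n (a - 1) (b - 1) * twoColDim N n (a + 1) (b + 1) < twoColDim N n a b ^ 2 := by
  obtain ⟨a, rfl⟩ : ∃ c, a = c + 1 := ⟨a - 1, by omega⟩
  obtain ⟨b, rfl⟩ : ∃ c, b = c + 1 := ⟨b - 1, by omega⟩
  have e0 := twoColDim_succ_succ (N := N) (n := n) (by omega) (show a ≤ b by omega) (by omega)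
  have e1 := twoColDim_succ_succ (N := N) (n := n) (by omega) hab hb
  have h1 : (b : ℝ) + 1 + 1 ≤ n := by exact_mod_cast hb
  have h2 : (a : ℝ) ≤ b := by exact_mod_cast (by omega : a ≤ b)
  have h3 : (n : ℝ) + 2 < N := by exact_mod_cast hn
  have h4 : (0 : ℝ) ≤ a := by positivity
  have hN : 2 ≤ N := by omega
  push_cast at e1
  have q1 : 0 < qnum N ((n : ℝ) - b) := qnum_pos hN (by linarith) (by linarith)
  have q2 : 0 < qnum N ((n : ℝ) + 1 - a) := qnum_pos hN (by linarith) (by linarith)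
  have q3 : 0 < qnum N ((b : ℝ) + 1 + 2) := qnum_pos hN (by linarith) (by linarith)
  have q4 : 0 < qnum N ((a : ℝ) + 1 + 1) := qnum_pos hN (by linarith) (by linarith)
  have q5 : 0 < qnum N ((b : ℝ) + 2) := qnum_pos hN (by linarith) (by linarith)
  have q6 : 0 < qnum N ((a : ℝ) + 1) := qnum_pos hN (by linarith) (by linarith)
  have q7 : 0 < qnum N ((n : ℝ) - (b + 1)) := qnum_pos hN (by linarith) (by linarith)
  have q8 : 0 < qnum N ((n : ℝ) + 1 - (a + 1)) := qnum_pos hN (by linarith) (by linarith)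
  refine mul_lt_sq_of_ratio (twoColDim_pos (by omega) hab hb.le) (mul_pos q1 q2)
    (mul_pos q3 q4) e0 e1 ?_
  have i1 := qnum_mul_lt_succ_mul_succ hN (x := (n : ℝ) - (b + 1)) (y := (b : ℝ) + 2)
    (by linarith) (by linarith)
  have i2 := qnum_mul_lt_succ_mul_succ hN (x := (n : ℝ) + 1 - (a + 1)) (y := (a : ℝ) + 1)
    (by linarith) (by linarith)
  rw [show (n : ℝ) - (b + 1) + 1 = n - b by ring,
    show (b : ℝ) + 2 + 1 = b + 1 + 2 by ring] at i1
  rw [show (n : ℝ) + 1 - (a + 1) + 1 = n + 1 - a by ring] at i2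
  have := mul_lt_mul'' i1 i2 (by positivity) (by positivity)
  linarith

theorem qbinom_one {n : ℕ} (hn : n < N) (h : 1 ≤ n) : qbinom N n 1 = qnum N n := by
  have := qbinom_succ hn (show 0 < n by omega)
  rw [qbinom_zero hn] at this
  simpa [qnum_one (show 2 ≤ N by omega)] using this

theorem twoColDim_adjoint {n : ℕ} (hn : n + 1 < N) (h : 2 ≤ n) :
    twoColDim N n 1 (n - 1) = qnum N ((n : ℝ) - 1) * qnum N ((n : ℝ) + 1) := by
  obtain ⟨n, rfl⟩ : ∃ m, n = m + 1 := ⟨n - 1, by omega⟩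
  have h1 := twoColDim_succ_left hn (show 0 < n by omega) (show n ≤ n + 1 by omega)
  rw [twoColDim_zero (by omega) (by omega),
    show qbinom N (n + 1) n = qbinom N (n + 1) 1 from qbinom_symm (n := n + 1) (b := 1) (by omega),
    qbinom_one (by omega) (by omega)] at h1
  have h3 : (n : ℝ) + 2 < N := by exact_mod_cast (by omega : n + 2 < N)
  have h4 : (0 : ℝ) ≤ n := by positivity
  have p : 0 < qnum N ((n : ℝ) + 1) := qnum_pos (by omega) (by linarith) (by linarith)
  push_cast at h1 ⊢
  simp only [sub_zero, zero_add, qnum_one (show 2 ≤ N by omega), one_mul] at h1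
  rw [add_sub_cancel_right]
  change twoColDim N (n + 1) 1 n = _
  refine mul_right_cancel₀ p.ne' ?_
  linear_combination h1

end dims

/-! ### Dimensions of Λ_a + Λ_b and of aΛ_1 -/

namespace SimpleObj

variable {r k : ℕ}

/-- The simple object `(k - 2) Λ_0 + Λ_a + Λ_b`. -/
def twoCol (h : 2 ≤ k) (a b : Fin (r + 1)) : SimpleObj r k where
  label := Pi.single 0 (k - 2) + Pi.single a 1 + Pi.single b 1
  sum_label := by
    simp [Finset.sum_add_distrib]
    omega

theorem sum_ite_single (a : Fin (r + 1)) (j m : ℕ) :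
    (∑ i : Fin (r + 1), if j < (i : ℕ) then (Pi.single a m : Fin (r + 1) → ℕ) i else 0) =
      if j < (a : ℕ) then m else 0 := by
  rw [Finset.sum_eq_single a]
  · simp
  · intro b _ hb; simp [Pi.single_eq_of_ne hb]
  · simp

theorem row_twoCol (h : 2 ≤ k) (a b : Fin (r + 1)) (j : ℕ) :
    (twoCol h a b).row j = (if j < (a : ℕ) then 1 else 0) + if j < (b : ℕ) then 1 else 0 := by
  rw [← sum_ite_single, ← sum_ite_single, row, ← Finset.sum_add_distrib]
  refine Finset.sum_congr rfl fun i _ => ?_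
  simp only [twoCol, Pi.add_apply]
  split_ifs with hj
  · have : i ≠ 0 := by rintro rfl; simp at hj
    simp [Pi.single_eq_of_ne this]
  · rfl

theorem row_multiple (a : ℕ) (b : Fin (r + 1)) (h : a ≤ k) (j : ℕ) :
    (multiple a b h).row j = if j < (b : ℕ) then a else 0 := by
  rw [← sum_ite_single, row]
  refine Finset.sum_congr rfl fun i _ => ?_
  simp only [multiple, Pi.add_apply]
  split_ifs with hj
  · have : i ≠ 0 := by rintro rfl; simp at hj
    simp [Pi.single_eq_of_ne this]
  · rfl

theorem realDim_twoCol (h : 2 ≤ k) (a b : Fin (r + 1)) (hab : a ≤ b) :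
    (twoCol h a b).realDim = twoColDim (r + 1 + k) (r + 1) a b := by
  set N := r + 1 + k with hN
  set X := twoCol h a b with hX
  have hab' : (a : ℕ) ≤ b := hab
  have hb : (b : ℕ) < r + 1 := b.2
  have hrow := row_twoCol h a b
  have hc0 : X.diagram.colLen 0 = b := by
    refine eq_of_forall_lt_iff fun i => ?_
    rw [lt_colLen_diagram, hrow]; split_ifs <;> omega
  have hc1 : X.diagram.colLen 1 = a := by
    refine eq_of_forall_lt_iff fun i => ?_
    rw [lt_colLen_diagram, hrow]; split_ifs <;> omega
  set F : ℕ → ℕ → ℝ := fun i j =>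
    qnum N ((r : ℝ) + 1 - i + j) / qnum N (hookLength X.diagram (i, j)) with hF
  have e1 : X.realDim = ∏ i ∈ Finset.range (r + 1),
      ((if i < (b : ℕ) then F i 0 else 1) * if i < (a : ℕ) then F i 1 else 1) := by
    refine Finset.prod_congr rfl fun i _ => ?_
    rw [hrow]
    split_ifs with h1 h2 h2
    · simp [Finset.prod_range_succ, hF, hN, div_mul_div_comm]
    · omega
    · simp [hF, hN]
    · simp
  rw [e1, Finset.prod_mul_distrib, prod_range_ite_lt _ hb.le, prod_range_ite_lt _ (by omega)]
  simp only [hF]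
  rw [Finset.prod_div_distrib, Finset.prod_div_distrib]
  have n0 : (∏ i ∈ Finset.range b, qnum N ((r : ℝ) + 1 - i + (0 : ℕ))) * qfact N (r + 1 - b) =
      qfact N (r + 1) := by
    rw [← prod_desc (r + 1) b hb.le]
    congr 1
    refine Finset.prod_congr rfl fun i _ => ?_
    push_cast; congr 1; ring
  have n1 : (∏ i ∈ Finset.range a, qnum N ((r : ℝ) + 1 - i + (1 : ℕ))) * qfact N (r + 1 + 1 - a) =
      qfact N (r + 1 + 1) := by
    rw [← prod_desc (r + 1 + 1) a (by omega)]
    congr 1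
    refine Finset.prod_congr rfl fun i _ => ?_
    push_cast; congr 1; ring
  have d1 : (∏ i ∈ Finset.range a, qnum N (hookLength X.diagram (i, 1) : ℝ)) = qfact N a := by
    rw [← prod_desc (a : ℕ) a le_rfl, Nat.sub_self, qfact_zero, mul_one]
    refine Finset.prod_congr rfl fun i hi => ?_
    have hi := Finset.mem_range.1 hi
    rw [← Nat.cast_sub hi.le]
    congr 2
    simp only [hookLength, rowLen_diagram, hc1]
    rw [hrow, if_pos hi, if_pos (by omega)]
    omega
  -- The hooks of the first column are b + 1, …, b - a + 2 in the rows with two boxes and b - a, …,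
  -- 1 in the others; only b - a + 1 is missing from [b + 1]!.
  have d0 : (∏ i ∈ Finset.range b, qnum N (hookLength X.diagram (i, 0) : ℝ)) *
      qnum N ((b : ℝ) - a + 1) = qfact N (b + 1) := by
    rw [← Finset.prod_range_mul_prod_Ico _ hab', ← prod_desc (b + 1 : ℕ) a (by omega), mul_assoc]
    congr 1
    · refine Finset.prod_congr rfl fun i hi => ?_
      have hi := Finset.mem_range.1 hi
      rw [← Nat.cast_sub (by omega)]
      congr 2
      simp only [hookLength, rowLen_diagram, hc0]
      rw [hrow, if_pos hi, if_pos (by omega)]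
      omega
    · rw [show (b : ℕ) + 1 - a = (b - a : ℕ) + 1 by omega, qfact_succ, Nat.cast_sub hab',
        ← prod_desc (b - a : ℕ) (b - a : ℕ) le_rfl, Nat.sub_self, qfact_zero, mul_one,
        Finset.prod_Ico_eq_prod_range]
      congr 1
      refine Finset.prod_congr rfl fun i hi => ?_
      have hi := Finset.mem_range.1 hi
      rw [← Nat.cast_sub hi.le]
      congr 2
      simp only [hookLength, rowLen_diagram, hc0]
      rw [hrow, if_neg (by omega), if_pos (by omega)]
      omega
  rw [d1, twoColDim, ← d0, ← n0, ← n1]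
  have p1 : 0 < qfact N (r + 1 - b) := qfact_pos (by omega)
  have p2 : 0 < qfact N (r + 1 + 1 - a) := qfact_pos (by omega)
  have p3 : 0 < qfact N a := qfact_pos (by omega)
  have p4 : 0 < qfact N (b + 1) := qfact_pos (by omega)
  have p5 : 0 < qnum N ((b : ℝ) - a + 1) := by
    have h1 : (a : ℝ) ≤ b := by exact_mod_cast hab'
    have h2 : (b : ℝ) + 1 < N := by exact_mod_cast (by omega : (b : ℕ) + 1 < N)
    have h3 : (0 : ℝ) ≤ a := by positivity
    exact qnum_pos (by omega) (by linarith) (by linarith)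
  rw [← d0] at p4
  have p6 := (pos_iff_pos_of_mul_pos p4).2 p5
  field_simp

/-- Level-rank duality for a row: [r + a]!/([r]! [a]!) becomes "k choose a" because [r]! [k]! = [N -
1]! = [r + a]! [k - a]!. -/
theorem realDim_multiple_one (hr : 1 ≤ r) (hk : 1 ≤ k) (a : ℕ) (h : a ≤ k) :
    (multiple a (1 : Fin (r + 1)) h).realDim = qbinom (r + 1 + k) k a := by
  set N := r + 1 + k with hN
  set X := multiple a (1 : Fin (r + 1)) h with hX
  have h1 : ((1 : Fin (r + 1)) : ℕ) = 1 := by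
    rw [Fin.val_one']; exact Nat.mod_eq_of_lt (by omega)
  have hrow : ∀ j, X.row j = if j < 1 then a else 0 := fun j => by rw [hX, row_multiple, h1]
  have hc : ∀ j, j < a → X.diagram.colLen j = 1 := fun j hj => by
    refine eq_of_forall_lt_iff fun i => ?_
    rw [lt_colLen_diagram, hrow]; split_ifs <;> omega
  rw [realDim, Finset.prod_eq_single_of_mem 0 (by simp)
    (fun i _ hi => by rw [hrow, if_neg (by omega)]; simp), hrow, if_pos (by omega),
    Finset.prod_div_distrib]
  have n0 : (∏ j ∈ Finset.range a, qnum N ((r : ℝ) + 1 - (0 : ℕ) + j)) * qfact N r =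
      qfact N (r + a) := by
    rw [← prod_asc]
    simp
  have d0 : (∏ j ∈ Finset.range a, qnum N (hookLength X.diagram (0, j) : ℝ)) = qfact N a := by
    rw [← prod_desc (a : ℕ) a le_rfl, Nat.sub_self, qfact_zero, mul_one]
    refine Finset.prod_congr rfl fun i hi => ?_
    have hi := Finset.mem_range.1 hi
    rw [← Nat.cast_sub hi.le]
    congr 2
    simp only [hookLength, rowLen_diagram, hc i hi]
    rw [hrow, if_pos (by omega)]
    omega
  have r1 := qfact_reflect (N := N) (by omega) (show r + k + 1 = N by omega)
  have r2 := qfact_reflect (N := N) (by omega) (show (r + a) + (k - a) + 1 = N by omega)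
  have p1 : 0 < qfact N r := qfact_pos (by omega)
  have p2 : 0 < qfact N a := qfact_pos (by omega)
  have p3 : 0 < qfact N (k - a) := qfact_pos (by omega)
  rw [d0, qbinom, div_eq_div_iff p2.ne' (by positivity)]
  rw [← mul_left_inj' p1.ne']
  linear_combination (qfact N a * qfact N (k - a)) * n0 + qfact N a * (r2 - r1)

end SimpleObj

/-! ### Numerical estimates and the cubic binomial equation -/

section analysis

variable {N : ℕ}

theorem qnum_two_eq (hN : 2 ≤ N) : qnum N 2 = 2 * Real.cos (Real.pi / N) := by
  have h := (sin_pi_div_pos hN).ne'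
  rw [qnum, Real.sin_two_mul]
  field_simp

theorem qnum_add_one_sub (hN : 2 ≤ N) (m : ℝ) :
    qnum N (m + 1) - qnum N (m - 1) = 2 * Real.cos (m * (Real.pi / N)) := by
  have h := (sin_pi_div_pos hN).ne'
  rw [qnum, qnum, ← sub_div, div_eq_iff h, add_mul, sub_mul, one_mul, Real.sin_add, Real.sin_sub]
  ring

theorem qnum_add_add_sub (m t : ℝ) :
    qnum N (m + t) + qnum N (m - t) = qnum N m * (2 * Real.cos (t * (Real.pi / N))) := by
  rw [qnum, qnum, qnum, ← add_div, add_mul, sub_mul, Real.sin_add, Real.sin_sub]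
  ring

/-- The Chebyshev recursion. It makes [m] a polynomial in [2]², times [2] when m is even, so that
the inequalities below concern one real variable close to its limit 4. -/
theorem qnum_add_two (hN : 2 ≤ N) (m : ℝ) :
    qnum N (m + 2) = qnum N 2 * qnum N (m + 1) - qnum N m := by
  have h := qnum_mul_sub (N := N) 1 m 1
  norm_num [qnum_one hN] at h
  rw [show 1 + m + 1 = m + 2 by ring] at h
  linarith

theorem qnum_three (hN : 2 ≤ N) : qnum N 3 = qnum N 2 ^ 2 - 1 := by
  have := qnum_add_two hN 1
  norm_num [qnum_one hN] at this
  rw [this]; ring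

theorem qnum_four (hN : 2 ≤ N) : qnum N 4 = qnum N 2 * (qnum N 2 ^ 2 - 2) := by
  have := qnum_add_two hN 2
  norm_num [qnum_three hN] at this
  rw [this]; ring

theorem qnum_five (hN : 2 ≤ N) : qnum N 5 = (qnum N 2 ^ 2) ^ 2 - 3 * qnum N 2 ^ 2 + 1 := by
  have := qnum_add_two hN 3
  norm_num [qnum_three hN, qnum_four hN] at this
  rw [this]; ring

theorem qnum_six (hN : 2 ≤ N) :
    qnum N 6 = qnum N 2 * ((qnum N 2 ^ 2) ^ 2 - 4 * qnum N 2 ^ 2 + 3) := by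
  have := qnum_add_two hN 4
  norm_num [qnum_four hN, qnum_five hN] at this
  rw [this]; ring

theorem qnum_seven (hN : 2 ≤ N) : qnum N 7 =
    (qnum N 2 ^ 2) ^ 3 - 5 * (qnum N 2 ^ 2) ^ 2 + 6 * qnum N 2 ^ 2 - 1 := by
  have := qnum_add_two hN 5
  norm_num [qnum_five hN, qnum_six hN] at this
  rw [this]; ring

theorem qnum_eight (hN : 2 ≤ N) : qnum N 8 =
    qnum N 2 * ((qnum N 2 ^ 2) ^ 3 - 6 * (qnum N 2 ^ 2) ^ 2 + 10 * qnum N 2 ^ 2 - 4) := by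
  have := qnum_add_two hN 6
  norm_num [qnum_six hN, qnum_seven hN] at this
  rw [this]; ring

theorem qnum_nine (hN : 2 ≤ N) : qnum N 9 = (qnum N 2 ^ 2) ^ 4 - 7 * (qnum N 2 ^ 2) ^ 3 +
    15 * (qnum N 2 ^ 2) ^ 2 - 10 * qnum N 2 ^ 2 + 1 := by
  have := qnum_add_two hN 7
  norm_num [qnum_seven hN, qnum_eight hN] at this
  rw [this]; ring

theorem qnum_ten (hN : 2 ≤ N) : qnum N 10 = qnum N 2 * ((qnum N 2 ^ 2) ^ 4 -
    8 * (qnum N 2 ^ 2) ^ 3 + 21 * (qnum N 2 ^ 2) ^ 2 - 20 * qnum N 2 ^ 2 + 5) := by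
  have := qnum_add_two hN 8
  norm_num [qnum_eight hN, qnum_nine hN] at this
  rw [this]; ring

theorem qnum_eleven (hN : 2 ≤ N) : qnum N 11 = (qnum N 2 ^ 2) ^ 5 - 9 * (qnum N 2 ^ 2) ^ 4 +
    28 * (qnum N 2 ^ 2) ^ 3 - 35 * (qnum N 2 ^ 2) ^ 2 + 15 * qnum N 2 ^ 2 - 1 := by
  have := qnum_add_two hN 9
  norm_num [qnum_nine hN, qnum_ten hN] at this
  rw [this]; ring

theorem qnum_two_lt (hN : 2 ≤ N) : qnum N 2 < 2 := by
  rw [qnum_two_eq hN]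
  have h1 := sin_pi_div_pos hN
  have := Real.sin_sq_add_cos_sq (Real.pi / N)
  nlinarith

/-- A numerical lower bound, `9.8697` being an upper bound of `π ^ 2`. -/
theorem le_qnum_two {M : ℕ} (hM : 2 ≤ M) (h : M ≤ N) :
    2 - 9.8697 / (M : ℝ) ^ 2 ≤ qnum N 2 := by
  rw [qnum_two_eq (hM.trans h)]
  have h1 := Real.one_sub_sq_div_two_le_cos (x := Real.pi / N)
  have h2 : Real.pi ^ 2 ≤ 9.8697 := by
    have := Real.pi_lt_d4
    have := Real.pi_pos
    nlinarith
  have h3 : (M : ℝ) ≤ N := by exact_mod_cast h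
  have h4 : (2 : ℝ) ≤ M := by exact_mod_cast hM
  have h5 : (Real.pi / N) ^ 2 ≤ 9.8697 / (M : ℝ) ^ 2 := by
    rw [div_pow]
    gcongr
  linarith

/-- Uses [n][n - 2] = [n + 1][n - 3] + [3]. The left side vanishes exactly when "n choose 3" equals
the adjoint dimension; the right side shows that its sign hinges on [n - 3] against [2][3]. -/
theorem phi_eq (hN : 2 ≤ N) (n : ℝ) :
    qnum N n * qnum N (n - 2) - qnum N 2 * qnum N 3 * qnum N (n + 1) =
      qnum N (n + 1) * (qnum N (n - 3) - qnum N 2 * qnum N 3) + qnum N 3 := by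
  have h := qnum_mul_sub (N := N) (-(n + 1)) (n - 3) 1
  rw [show -(n + 1) + 1 = -n by ring, show n - 3 + 1 = n - 2 by ring,
    show -(n + 1) + (n - 3) + 1 = -3 by ring, qnum_neg, qnum_neg, qnum_neg, qnum_one hN] at h
  linarith

theorem qnum_two_mul_three (hN : 2 ≤ N) : qnum N 2 * qnum N 3 = qnum N 4 + qnum N 2 := by
  rw [qnum_three hN, qnum_four hN]; ring

/-- [5] - [3] = 2cos(4π/N) equals 1 only at N = 12. In the proof this appears as [8] = [4]([5] -
[3]). -/
theorem qnum_five_sub_three_sub_one_ne (hN : 12 < N ∨ (7 ≤ N ∧ N < 12)) :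
    qnum N 5 - qnum N 3 - 1 ≠ 0 := by
  have h2 : 2 ≤ N := by omega
  intro h
  have h8 : qnum N 4 = qnum N 8 := by
    have e : qnum N 8 = qnum N 4 * (qnum N 5 - qnum N 3) := by
      rw [qnum_eight h2, qnum_four h2, qnum_five h2, qnum_three h2]; ring
    rw [e, show qnum N 5 - qnum N 3 = 1 by linarith, mul_one]
  by_cases h9 : 8 ≤ N
  · have h10 : (8 : ℝ) ≤ N := by exact_mod_cast h9
    have := qnum_injective_of_lt h2 (by norm_num) (by norm_num) h10 h8
    have h12 : 12 = N := by exact_mod_cast (by linarith : (12 : ℝ) = N)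
    omega
  · have h7 : N = 7 := by omega
    subst h7
    have h1 : qnum 7 4 > 0 := qnum_pos (by norm_num) (by norm_num) (by norm_num)
    have h3 := qnum_reflect (N := 7) (by norm_num) (-1)
    have h4 := qnum_neg (N := 7) 1
    norm_num [qnum_one] at h3 h4
    rw [h8, h3, h4] at h1
    norm_num at h1

/-- `[n] [n - 2] = [2] [3] [n + 1]` fails for `n = 6, 7, 8`. -/
theorem phi_ne_of_lt {n k : ℕ} (hN : n + k = N) (hk : 2 ≤ k) (h6 : 6 ≤ n) (h8 : n ≤ 8) :
    qnum N n * qnum N ((n : ℝ) - 2) - qnum N 2 * qnum N 3 * qnum N ((n : ℝ) + 1) ≠ 0 := by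
  have h2 : 2 ≤ N := by omega
  have hNr : (n : ℝ) + k = N := by exact_mod_cast hN
  have hk' : (2 : ℝ) ≤ k := by exact_mod_cast hk
  have h6' : (6 : ℝ) ≤ n := by exact_mod_cast h6
  have p2 : 0 < qnum N 2 := qnum_pos h2 (by norm_num) (by linarith)
  have p3 : 0 < qnum N 3 := qnum_pos h2 (by norm_num) (by linarith)
  rcases hk.eq_or_lt with rfl | hk3
  · push_cast at hNr
    rw [qnum_eq_of_add h2 (show (n : ℝ) + 2 = N by linarith),
      qnum_eq_of_add h2 (show (n : ℝ) - 2 + 4 = N by linarith),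
      qnum_eq_of_add h2 (show (n : ℝ) + 1 + 1 = N by linarith), qnum_one h2]
    have := qnum_strictMono h2 (x := 3) (y := 4) (by norm_num) (by norm_num) (by linarith)
    nlinarith
  rcases (Nat.succ_le_of_lt hk3).eq_or_lt with hk3 | hk4
  · have hk3 : k = 3 := by omega
    subst hk3
    push_cast at hNr
    rw [qnum_eq_of_add h2 (show (n : ℝ) + 3 = N by linarith),
      qnum_eq_of_add h2 (show (n : ℝ) - 2 + 5 = N by linarith),
      qnum_eq_of_add h2 (show (n : ℝ) + 1 + 2 = N by linarith)]
    have := qnum_five_sub_three_sub_one_ne (N := N) (Or.inr (by omega))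
    have e : qnum N 3 * qnum N 5 - qnum N 2 * qnum N 3 * qnum N 2 =
      qnum N 3 * (qnum N 5 - qnum N 3 - 1) := by rw [qnum_three h2]; ring
    rw [e]
    exact mul_ne_zero p3.ne' this
  have hk4 : (4 : ℝ) ≤ k := by exact_mod_cast (by omega : 4 ≤ k)
  have hx := qnum_two_lt h2
  have a1 : qnum N 3 ≤ qnum N ((n : ℝ) + 1) := by
    rw [qnum_eq_of_add h2 (show (n : ℝ) + 1 + (k - 1) = N by linarith)]
    exact qnum_mono h2 (by norm_num) (by linarith) (by linarith)
  refine ne_of_lt ?_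
  rw [phi_eq h2, qnum_two_mul_three h2]
  -- Since [n + 1] ≥ [3], a gap larger than 1 between [2][3] = [4] + [2] and [n - 3] makes the
  -- expression negative.
  suffices h : qnum N ((n : ℝ) - 3) + 1 < qnum N 4 + qnum N 2 by nlinarith
  have l2 : 1.9 ≤ qnum N 2 := by
    have := le_qnum_two (N := N) (M := 10) (by norm_num) (by omega)
    norm_num at this ⊢; linarith
  obtain rfl | rfl | rfl : n = 6 ∨ n = 7 ∨ n = 8 := by omega
  · norm_num
    rw [qnum_three h2, qnum_four h2]; nlinarith
  · norm_num; linarith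
  · norm_num
    rw [qnum_five h2, qnum_four h2]
    generalize qnum N 2 = x at *
    have : x * (x ^ 2 - 2) + x - ((x ^ 2) ^ 2 - 3 * x ^ 2 + 1 + 1) =
      (x ^ 2 - 1) * ((2 - x) * (1 + x)) := by ring
    have : 0 < (x ^ 2 - 1) * ((2 - x) * (1 + x)) :=
      mul_pos (by nlinarith) (mul_pos (by linarith) (by linarith))
    linarith

/-- With w = [5] - [3] = 2cos(4π/N) the expression is [3](w - 1)(w² - 3). The root w = 1 gives N =
12, and w² = 3 gives N = 24. -/
theorem phi_nine {k : ℕ} (hN : 9 + k = N) (hk : 2 ≤ k)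
    (h : qnum N 9 * qnum N 7 - qnum N 2 * qnum N 3 * qnum N 10 = 0) : k = 3 ∨ k = 15 := by
  have h2 : 2 ≤ N := by omega
  have h11 : (11 : ℝ) ≤ N := by exact_mod_cast (by omega : 11 ≤ N)
  have p3 : 0 < qnum N 3 := qnum_pos h2 (by norm_num) (by linarith)
  have p8 : 0 < qnum N 8 := qnum_pos h2 (by norm_num) (by linarith)
  set w := qnum N 5 - qnum N 3 with hw
  have hw' : w = (qnum N 2 ^ 2) ^ 2 - 4 * qnum N 2 ^ 2 + 2 := by
    rw [hw, qnum_five h2, qnum_three h2]; ring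
  have e : qnum N 9 * qnum N 7 - qnum N 2 * qnum N 3 * qnum N 10 =
      qnum N 3 * ((w - 1) * (w ^ 2 - 3)) := by
    rw [hw', qnum_nine h2, qnum_seven h2, qnum_three h2, qnum_ten h2]; ring
  rw [e] at h
  rcases mul_eq_zero.1 h with h | h
  · exact absurd h p3.ne'
  rcases mul_eq_zero.1 h with h | h
  · left
    by_contra hk3
    exact qnum_five_sub_three_sub_one_ne (N := N) (by omega) h
  · right
    -- From [12] + [4] = [8]w, [16] + [8] = [12]w and [8] = [4]w one gets [16] = [8](w² - 2), which
    -- is [8] when w² = 3.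
    have e16 : qnum N 16 = qnum N 8 := by
      have hc := qnum_add_one_sub h2 4
      have a1 := qnum_add_add_sub (N := N) 8 4
      have a2 := qnum_add_add_sub (N := N) 12 4
      norm_num at hc a1 a2
      rw [← hc] at a1 a2
      have e8 : qnum N 8 = qnum N 4 * w := by
        rw [hw', qnum_eight h2, qnum_four h2]; ring
      rw [← hw] at a1 a2
      linear_combination a2 + w * a1 + qnum N 8 * h + e8
    by_cases h16 : 16 ≤ N
    · have h16' : (16 : ℝ) ≤ N := by exact_mod_cast h16
      have := qnum_injective_of_lt h2 (by norm_num) (by norm_num) h16' e16.symm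
      have h24 : 24 = N := by exact_mod_cast (by linarith : (24 : ℝ) = N)
      omega
    · have h16' : (N : ℝ) < 16 := by exact_mod_cast (by omega : N < 16)
      have h3 := qnum_reflect (N := N) h2 (N - 16)
      rw [show (N : ℝ) - (N - 16) = 16 by ring, show (N : ℝ) - 16 = -(16 - N) by ring,
        qnum_neg] at h3
      have := qnum_pos h2 (N := N) (m := 16 - N) (by linarith) (by linarith)
      linarith

/-- Small k is treated by reflecting the arguments to k and bounding a polynomial in [2]²; for large
N, [n - 3] ≥ [8] ≥ [2][3] and `phi_eq` suffices. -/
theorem phi_pos {n k : ℕ} (hN : n + k = N) (hk : 2 ≤ k) (h10 : 10 ≤ n) :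
    qnum N 2 * qnum N 3 * qnum N ((n : ℝ) + 1) < qnum N n * qnum N ((n : ℝ) - 2) := by
  have h2 : 2 ≤ N := by omega
  have hNr : (n : ℝ) + k = N := by exact_mod_cast hN
  have hk' : (2 : ℝ) ≤ k := by exact_mod_cast hk
  have h10' : (10 : ℝ) ≤ n := by exact_mod_cast h10
  have p2 : 0 < qnum N 2 := qnum_pos h2 (by norm_num) (by linarith)
  have p3 : 0 < qnum N 3 := qnum_pos h2 (by norm_num) (by linarith)
  have hx := qnum_two_lt h2
  rw [← sub_pos]
  rcases hk.eq_or_lt with rfl | hk3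
  · push_cast at hNr
    rw [qnum_eq_of_add h2 (show (n : ℝ) + 2 = N by linarith),
      qnum_eq_of_add h2 (show (n : ℝ) - 2 + 4 = N by linarith),
      qnum_eq_of_add h2 (show (n : ℝ) + 1 + 1 = N by linarith), qnum_one h2]
    have := qnum_strictMono h2 (x := 3) (y := 4) (by norm_num) (by norm_num) (by linarith)
    nlinarith
  rcases (Nat.succ_le_of_lt hk3).eq_or_lt with hk3 | hk4
  · have hk3 : k = 3 := by omega
    subst hk3
    push_cast at hNr
    rw [qnum_eq_of_add h2 (show (n : ℝ) + 3 = N by linarith),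
      qnum_eq_of_add h2 (show (n : ℝ) - 2 + 5 = N by linarith),
      qnum_eq_of_add h2 (show (n : ℝ) + 1 + 2 = N by linarith)]
    have e : qnum N 3 * qnum N 5 - qnum N 2 * qnum N 3 * qnum N 2 =
      qnum N 3 * ((qnum N 2 ^ 2) ^ 2 - 4 * qnum N 2 ^ 2 + 1) := by
      rw [qnum_five h2, qnum_three h2]; ring
    rw [e]
    refine mul_pos p3 ?_
    have l := le_qnum_two (N := N) (M := 13) (by norm_num) (by omega)
    norm_num at l
    have : 3.76 ≤ qnum N 2 ^ 2 := by norm_num; nlinarith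
    norm_num at this
    nlinarith
  rcases (Nat.succ_le_of_lt hk4).eq_or_lt with hk4 | hk5
  · have hk4 : k = 4 := by omega
    subst hk4
    push_cast at hNr
    rw [qnum_eq_of_add h2 (show (n : ℝ) + 4 = N by linarith),
      qnum_eq_of_add h2 (show (n : ℝ) - 2 + 6 = N by linarith),
      qnum_eq_of_add h2 (show (n : ℝ) + 1 + 3 = N by linarith),
      qnum_three h2, qnum_four h2, qnum_six h2]
    have l := le_qnum_two (N := N) (M := 14) (by norm_num) (by omega)
    norm_num at l
    generalize qnum N 2 = x at *
    have hy : 3.8 ≤ x ^ 2 := by norm_num; nlinarith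
    -- The tangent bound at x = 2 removes the odd power of x. Expanding the resulting polynomial in
    -- y = x² around the lower bound of y then leaves positive coefficients.
    have hxy : x ≤ (x ^ 2 + 4) / 4 := by nlinarith [sq_nonneg (x - 2)]
    have e : x * (x ^ 2 - 2) * (x * ((x ^ 2) ^ 2 - 4 * x ^ 2 + 3)) -
      x * (x ^ 2 - 1) * (x ^ 2 - 1) =
      x * (x ^ 2 - 1) * (x * (x ^ 2 - 2) * (x ^ 2 - 3) - (x ^ 2 - 1)) := by ring
    rw [e]
    norm_num at hy
    refine mul_pos (mul_pos p2 (by linarith)) ?_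
    have h3 : 0 < x ^ 2 * (x ^ 2 - 2) * (x ^ 2 - 3) - (x ^ 2 + 4) / 4 * (x ^ 2 - 1) := by
      generalize x ^ 2 = y at *
      obtain ⟨w, rfl⟩ : ∃ w, y = 19 / 5 + w := ⟨y - 19 / 5, by ring⟩
      have hw : 0 ≤ w := by linarith
      ring_nf
      positivity
    have h4 : x * (x ^ 2 - 1) ≤ (x ^ 2 + 4) / 4 * (x ^ 2 - 1) :=
      mul_le_mul_of_nonneg_right hxy (by linarith)
    have h5 : 0 < x * (x * (x ^ 2 - 2) * (x ^ 2 - 3) - (x ^ 2 - 1)) := by nlinarith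
    exact (pos_iff_pos_of_mul_pos h5).1 p2
  have hk5' : (5 : ℝ) ≤ k := by exact_mod_cast hk5
  rw [phi_eq h2]
  have p1 : 0 < qnum N ((n : ℝ) + 1) := qnum_pos h2 (by linarith) (by linarith)
  rcases h10.eq_or_lt with rfl | h11
  · norm_num
    rw [qnum_eleven h2, qnum_seven h2, qnum_three h2]
    have l := le_qnum_two (N := N) (M := 15) (by norm_num) (by omega)
    norm_num at p1
    rw [qnum_eleven h2] at p1
    norm_num at l
    generalize qnum N 2 = x at *
    have hy : 3.8264 ≤ x ^ 2 := by norm_num; nlinarith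
    have hxy : x ≤ (x ^ 2 + 4) / 4 := by nlinarith [sq_nonneg (x - 2)]
    norm_num at hy
    generalize x ^ 2 = y at *
    have h4 : x * (y - 1) ≤ (y + 4) / 4 * (y - 1) :=
      mul_le_mul_of_nonneg_right hxy (by linarith)
    have h5 := mul_le_mul_of_nonneg_left h4 p1.le
    suffices h3 : 0 < (y ^ 5 - 9 * y ^ 4 + 28 * y ^ 3 - 35 * y ^ 2 + 15 * y - 1) *
        (y ^ 3 - 5 * y ^ 2 + 6 * y - 1 - (y + 4) / 4 * (y - 1)) + (y - 1) by linarith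
    obtain ⟨w, rfl⟩ : ∃ w, y = 4783 / 1250 + w := ⟨y - 4783 / 1250, by ring⟩
    have hw : 0 ≤ w := by linarith
    ring_nf
    positivity
  have h11' : (11 : ℝ) ≤ n := by exact_mod_cast h11
  have a1 : qnum N 8 ≤ qnum N ((n : ℝ) - 3) := by
    rcases le_total ((n : ℝ) - 3 + 8) N with h | h
    · exact qnum_mono h2 (by norm_num) (by linarith) (by linarith)
    · rw [qnum_eq_of_add h2 (show (n : ℝ) - 3 + (k + 3) = N by linarith)]
      exact qnum_mono h2 (by norm_num) (by linarith) (by linarith)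
  have e : qnum N 8 - qnum N 2 * qnum N 3 = qnum N 2 * (qnum N 7 - qnum N 5 - 1) := by
    rw [qnum_eight h2, qnum_three h2, qnum_seven h2, qnum_five h2]; ring
  -- [7] - [5] = 2cos(6π/N) is at least 1 exactly from N = 18 on.
  by_cases h18 : 18 ≤ N
  · have hc := qnum_add_one_sub h2 6
    have : 1 / 2 ≤ Real.cos (6 * (Real.pi / N)) := by
      rw [← Real.cos_pi_div_three]
      have h18' : (18 : ℝ) ≤ N := by exact_mod_cast h18
      have hpi := Real.pi_pos
      refine Real.cos_le_cos_of_nonneg_of_le_pi (by positivity) (by linarith) ?_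
      rw [← mul_div_assoc, div_le_div_iff₀ (by linarith) (by norm_num)]
      nlinarith
    norm_num at hc
    have h3 : 0 ≤ qnum N 2 * (qnum N 7 - qnum N 5 - 1) := mul_nonneg p2.le (by linarith)
    have : 0 ≤ qnum N ((n : ℝ) - 3) - qnum N 2 * qnum N 3 := by linarith
    have := mul_nonneg p1.le this
    linarith
  -- Only N = 16 and 17 remain. There [8] - [2][3] ≥ -1/2 and [n + 1] ≤ 5, so the loss is at most
  -- 5/2, less than [3] ≥ 2.8.
  · have hk6 : (k : ℝ) ≤ 6 := by exact_mod_cast (by omega : k ≤ 6)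
    have a2 : qnum N ((n : ℝ) + 1) ≤ qnum N 5 := by
      rw [qnum_eq_of_add h2 (show (n : ℝ) + 1 + (k - 1) = N by linarith)]
      exact qnum_mono h2 (by linarith) (by linarith) (by linarith)
    have l := le_qnum_two (N := N) (M := 16) (by norm_num) (by omega)
    norm_num at l
    have a3 : -0.5 ≤ qnum N 8 - qnum N 2 * qnum N 3 := by
      rw [e, qnum_seven h2, qnum_five h2]
      generalize qnum N 2 = x at *
      have hy : 3.846 ≤ x ^ 2 := by norm_num; nlinarith
      norm_num at hy ⊢
      generalize x ^ 2 = y at *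
      have : -1 / 4 ≤ y ^ 3 - 5 * y ^ 2 + 6 * y - 1 - (y ^ 2 - 3 * y + 1) - 1 := by
        obtain ⟨w, rfl⟩ : ∃ w, y = 1923 / 500 + w := ⟨y - 1923 / 500, by ring⟩
        have hw : 0 ≤ w := by linarith
        have : 0 < w ^ 3 + w ^ 2 * 5 + w * 7 + 1 := by positivity
        ring_nf
        nlinarith [pow_nonneg hw 3, pow_nonneg hw 2]
      nlinarith
    have a4 : qnum N 5 ≤ 5 := by
      rw [qnum_five h2]
      generalize qnum N 2 = x at *
      have hy : x ^ 2 ≤ 4 := by nlinarith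
      nlinarith
    have a5 : 2.8 ≤ qnum N 3 := by
      rw [qnum_three h2]; norm_num; nlinarith
    norm_num at a3 a5
    have : -(1 / 2) ≤ qnum N ((n : ℝ) - 3) - qnum N 2 * qnum N 3 := by linarith
    nlinarith

end analysis

/-! ### Quantum binomials and 2Λ_2 against the adjoint dimension -/

section analysis

variable {N : ℕ}

/-- The inequality behind "n choose 4" exceeding the adjoint dimension. For n ≥ 10 it is `phi_pos`
multiplied by [n - 3] ≥ [4]; only n = 9, where `phi_pos` is unavailable, needs its own estimate. -/
theorem psi_pos {n k : ℕ} (hN : n + k = N) (hk : 2 ≤ k) (h9 : 9 ≤ n) :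
    qnum N 2 * qnum N 3 * qnum N 4 * qnum N ((n : ℝ) + 1) <
      qnum N n * qnum N ((n : ℝ) - 2) * qnum N ((n : ℝ) - 3) := by
  have h2 : 2 ≤ N := by omega
  have hNr : (n : ℝ) + k = N := by exact_mod_cast hN
  have hk' : (2 : ℝ) ≤ k := by exact_mod_cast hk
  have h9' : (9 : ℝ) ≤ n := by exact_mod_cast h9
  have p2 : 0 < qnum N 2 := qnum_pos h2 (by norm_num) (by linarith)
  have p3 : 0 < qnum N 3 := qnum_pos h2 (by norm_num) (by linarith)
  have p4 : 0 < qnum N 4 := qnum_pos h2 (by norm_num) (by linarith)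
  have pn : 0 < qnum N ((n : ℝ) + 1) := qnum_pos h2 (by linarith) (by linarith)
  have hx := qnum_two_lt h2
  rcases h9.eq_or_lt with rfl | h10
  · norm_num
    rw [← sub_pos]
    have e : qnum N 9 * qnum N 7 * qnum N 6 - qnum N 2 * qnum N 3 * qnum N 4 * qnum N 10 =
        qnum N 2 * qnum N 3 * (((qnum N 2 ^ 2) ^ 3 - 6 * (qnum N 2 ^ 2) ^ 2 + 9 * qnum N 2 ^ 2 - 1) *
          ((qnum N 2 ^ 2) ^ 3 - 5 * (qnum N 2 ^ 2) ^ 2 + 6 * qnum N 2 ^ 2 - 1) *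
          (qnum N 2 ^ 2 - 1) * (qnum N 2 ^ 2 - 3) - qnum N 2 ^ 2 * (qnum N 2 ^ 2 - 2) *
          ((qnum N 2 ^ 2) ^ 4 - 8 * (qnum N 2 ^ 2) ^ 3 + 21 * (qnum N 2 ^ 2) ^ 2 -
            20 * qnum N 2 ^ 2 + 5)) := by
      rw [qnum_nine h2, qnum_seven h2, qnum_six h2, qnum_three h2, qnum_four h2, qnum_ten h2]
      ring
    rw [e]
    refine mul_pos (mul_pos p2 p3) ?_
    have l := le_qnum_two (N := N) (M := 11) (by norm_num) (by omega)
    norm_num at l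
    generalize qnum N 2 = x at *
    have hy : 3.68 ≤ x ^ 2 := by norm_num; nlinarith
    norm_num at hy
    generalize x ^ 2 = y at *
    obtain ⟨w, rfl⟩ : ∃ w, y = 92 / 25 + w := ⟨y - 92 / 25, by ring⟩
    have hw : 0 ≤ w := by linarith
    have h3 := pow_nonneg hw 3
    have h4 := pow_nonneg hw 4
    have h5 := pow_nonneg hw 5
    have h6 := pow_nonneg hw 6
    have h7 := pow_nonneg hw 7
    have h8 := pow_nonneg hw 8
    -- The polynomial still decreases at y = 92/25, so its linear coefficient in w is negative; this
    -- square absorbs it.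
    have hq := sq_nonneg (w - 1 / 30)
    ring_nf at hq ⊢
    linarith
  · have h1 := phi_pos hN hk h10
    have h10' : (10 : ℝ) ≤ n := by exact_mod_cast h10
    have h3 : qnum N 4 ≤ qnum N ((n : ℝ) - 3) :=
      qnum_mono h2 (by norm_num) (by linarith) (by linarith)
    calc _ = qnum N 2 * qnum N 3 * qnum N ((n : ℝ) + 1) * qnum N 4 := by ring
      _ < _ := mul_lt_mul h1 h3 p4 (by nlinarith [mul_pos (mul_pos p2 p3) pn])

/-- The difference of the two sides is [3][4]([8] - [6])([5] - [3] - 1); the last two factors vanish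
at N = 14 and N = 12. -/
theorem psi_eight {k : ℕ} (hN : 8 + k = N) (hk : 2 ≤ k)
    (h : qnum N 8 * qnum N 6 * qnum N 5 = qnum N 2 * qnum N 3 * qnum N 4 * qnum N 9) :
    k = 4 ∨ k = 6 := by
  have h2 : 2 ≤ N := by omega
  have h10 : (10 : ℝ) ≤ N := by exact_mod_cast (by omega : 10 ≤ N)
  have p3 : 0 < qnum N 3 := qnum_pos h2 (by norm_num) (by linarith)
  have p4 : 0 < qnum N 4 := qnum_pos h2 (by norm_num) (by linarith)
  have e : qnum N 8 * qnum N 6 * qnum N 5 - qnum N 2 * qnum N 3 * qnum N 4 * qnum N 9 =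
      qnum N 3 * qnum N 4 * ((qnum N 8 - qnum N 6) * (qnum N 5 - qnum N 3 - 1)) := by
    rw [qnum_eight h2, qnum_six h2, qnum_five h2, qnum_nine h2, qnum_four h2, qnum_three h2]
    ring
  rw [h, sub_self] at e
  rcases mul_eq_zero.1 e.symm with h3 | h3
  · exact absurd h3 (mul_pos p3 p4).ne'
  rcases mul_eq_zero.1 h3 with h3 | h3
  · right
    have := qnum_injective_of_lt h2 (x := 6) (y := 8) (by norm_num) (by norm_num) (by linarith)
      (by linarith)
    have : 14 = N := by exact_mod_cast (by linarith : (14 : ℝ) = N)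
    omega
  · left
    by_contra hk4
    exact qnum_five_sub_three_sub_one_ne (N := N) (by omega) h3

theorem qnum_sub_one_mul_add_one (hN : 2 ≤ N) (n : ℝ) :
    qnum N (n - 1) * qnum N (n + 1) = qnum N n ^ 2 - 1 := by
  rw [mul_comm, qnum_add_mul_sub, qnum_one hN, one_pow]

theorem qnum_adjoint_pos {n k : ℕ} (hN : n + k = N) (hn : 2 ≤ n) (hk : 2 ≤ k) :
    0 < qnum N ((n : ℝ) - 1) * qnum N ((n : ℝ) + 1) := by
  have hNr : (n : ℝ) + k = N := by exact_mod_cast hN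
  have hk' : (2 : ℝ) ≤ k := by exact_mod_cast hk
  have hn' : (2 : ℝ) ≤ n := by exact_mod_cast hn
  exact mul_pos (qnum_pos (by omega) (by linarith) (by linarith))
    (qnum_pos (by omega) (by linarith) (by linarith))

/-- With z = [n] the equation is z = z² - 1. For n, k ≥ 3 one has z ≥ [3] ≥ 1.9, beyond the golden
ratio; n = 2 or k = 2 gives [2] = [3]. -/
theorem qnum_ne_adjoint {n k : ℕ} (hN : n + k = N) (hn : 2 ≤ n) (hk : 2 ≤ k)
    (h : qnum N n = qnum N ((n : ℝ) - 1) * qnum N ((n : ℝ) + 1)) : N = 5 := by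
  have h2 : 2 ≤ N := by omega
  have hNr : (n : ℝ) + k = N := by exact_mod_cast hN
  have hk' : (2 : ℝ) ≤ k := by exact_mod_cast hk
  have hn' : (2 : ℝ) ≤ n := by exact_mod_cast hn
  have key : qnum N 2 = qnum N 3 → N = 5 := fun h => by
    have hN4 : 4 ≤ N := by omega
    have hN4' : (4 : ℝ) ≤ N := by exact_mod_cast hN4
    have := qnum_injective_of_lt h2 (x := 2) (y := 3) (by norm_num) (by norm_num) (by linarith) h
    exact_mod_cast (by linarith : (N : ℝ) = 5)
  rcases hn.eq_or_lt with rfl | hn3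
  · apply key
    norm_num [qnum_one h2] at h
    exact h
  rcases hk.eq_or_lt with rfl | hk3
  · apply key
    push_cast at hNr
    rwa [qnum_eq_of_add h2 (show (n : ℝ) + 2 = N by linarith),
      qnum_eq_of_add h2 (show (n : ℝ) - 1 + 3 = N by linarith),
      qnum_eq_of_add h2 (show (n : ℝ) + 1 + 1 = N by linarith), qnum_one h2, mul_one] at h
  exfalso
  rw [qnum_sub_one_mul_add_one h2] at h
  have hk3' : (3 : ℝ) ≤ k := by exact_mod_cast hk3
  have hn3' : (3 : ℝ) ≤ n := by exact_mod_cast hn3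
  have h3 : qnum N 3 ≤ qnum N n := qnum_mono h2 (by norm_num) (by linarith) (by linarith)
  have l := le_qnum_two (N := N) (M := 6) (by norm_num) (by omega)
  rw [qnum_three h2] at h3
  norm_num at l
  have : 1.9 ≤ qnum N n := by norm_num; nlinarith
  norm_num at this
  nlinarith

theorem qbinom_two_mul {n : ℕ} (hn : n < N) (h : 2 ≤ n) :
    qbinom N n 2 * qnum N 2 = qnum N n * qnum N ((n : ℝ) - 1) := by
  have := qbinom_succ hn (show 1 < n by omega)
  rw [qbinom_one hn (by omega)] at this
  norm_num at this
  exact this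

theorem qbinom_three_mul {n : ℕ} (hn : n < N) (h : 3 ≤ n) :
    qbinom N n 3 * (qnum N 2 * qnum N 3) = qnum N n * qnum N ((n : ℝ) - 1) * qnum N ((n : ℝ) - 2) := by
  have h1 := qbinom_two_mul hn (show 2 ≤ n by omega)
  have := qbinom_succ hn (show 2 < n by omega)
  norm_num at this
  linear_combination qnum N 2 * this + qnum N ((n : ℝ) - 2) * h1

theorem qbinom_four_mul {n : ℕ} (hn : n < N) (h : 4 ≤ n) :
    qbinom N n 4 * (qnum N 2 * qnum N 3 * qnum N 4) =
      qnum N n * qnum N ((n : ℝ) - 1) * qnum N ((n : ℝ) - 2) * qnum N ((n : ℝ) - 3) := by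
  have h1 := qbinom_three_mul hn (show 3 ≤ n by omega)
  have := qbinom_succ hn (show 3 < n by omega)
  norm_num at this
  linear_combination qnum N 2 * qnum N 3 * this + qnum N ((n : ℝ) - 3) * h1

theorem adjoint_lt_qbinom_four {n k : ℕ} (hN : n + k = N) (hk : 2 ≤ k) (h9 : 9 ≤ n) :
    qnum N ((n : ℝ) - 1) * qnum N ((n : ℝ) + 1) < qbinom N n 4 := by
  have h2 : 2 ≤ N := by omega
  have hNr : (n : ℝ) + k = N := by exact_mod_cast hN
  have hk' : (2 : ℝ) ≤ k := by exact_mod_cast hk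
  have h9' : (9 : ℝ) ≤ n := by exact_mod_cast h9
  have p2 : 0 < qnum N 2 := qnum_pos h2 (by norm_num) (by linarith)
  have p3 : 0 < qnum N 3 := qnum_pos h2 (by norm_num) (by linarith)
  have p4 : 0 < qnum N 4 := qnum_pos h2 (by norm_num) (by linarith)
  have pn : 0 < qnum N ((n : ℝ) - 1) := qnum_pos h2 (by linarith) (by linarith)
  refine lt_of_mul_lt_mul_right ?_ (mul_pos (mul_pos p2 p3) p4).le
  rw [qbinom_four_mul (by omega) (by omega)]
  have := mul_lt_mul_of_pos_left (psi_pos hN hk h9) pn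
  linarith

/-- Both sides share the factor [n - 1]. What remains is [n + 2] = 0 for b = 2 and the two equations
studied above for b = 3 and b = 4; larger b is excluded by log-concavity. -/
theorem qbinom_eq_adjoint_of_le {n k b : ℕ} (hN : n + k = N) (hk : 2 ≤ k)
    (hb : 1 ≤ b) (hbn : 2 * b ≤ n)
    (h : qbinom N n b = qnum N ((n : ℝ) - 1) * qnum N ((n : ℝ) + 1)) :
    (b = 1 ∧ N = 5) ∨ (b = 2 ∧ k = 2) ∨ (b = 3 ∧ n = 9 ∧ (k = 3 ∨ k = 15)) ∨
      (b = 4 ∧ n = 8 ∧ (k = 4 ∨ k = 6)) := by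
  have h2 : 2 ≤ N := by omega
  have hn : n < N := by omega
  have hNr : (n : ℝ) + k = N := by exact_mod_cast hN
  have hk' : (2 : ℝ) ≤ k := by exact_mod_cast hk
  have hn2 : (2 : ℝ) ≤ n := by exact_mod_cast (by omega : 2 ≤ n)
  have p2 : 0 < qnum N 2 := qnum_pos h2 (by norm_num) (by linarith)
  have pn : 0 < qnum N ((n : ℝ) - 1) := qnum_pos h2 (by linarith) (by linarith)
  rcases (by omega : b = 1 ∨ b = 2 ∨ b = 3 ∨ 4 ≤ b) with rfl | rfl | rfl | hb4
  · rw [qbinom_one hn (by omega)] at h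
    exact Or.inl ⟨rfl, qnum_ne_adjoint hN (by omega) hk h⟩
  · refine Or.inr (Or.inl ⟨rfl, ?_⟩)
    have h1 := qbinom_two_mul hn (by omega)
    rw [h] at h1
    have h3 : qnum N n = qnum N 2 * qnum N ((n : ℝ) + 1) :=
      mul_left_cancel₀ pn.ne' (by linarith)
    have h4 := qnum_add_two h2 (n : ℝ)
    by_contra hk2
    have hk3 : (3 : ℝ) ≤ k := by exact_mod_cast (by omega : 3 ≤ k)
    have := qnum_pos h2 (N := N) (m := (n : ℝ) + 2) (by linarith) (by linarith)
    linarith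
  · refine Or.inr (Or.inr (Or.inl ⟨rfl, ?_⟩))
    have h1 := qbinom_three_mul hn (by omega)
    rw [h] at h1
    have h3 : qnum N n * qnum N ((n : ℝ) - 2) - qnum N 2 * qnum N 3 * qnum N ((n : ℝ) + 1) = 0 :=
      mul_left_cancel₀ pn.ne' (by linarith)
    rcases (by omega : n ≤ 8 ∨ n = 9 ∨ 10 ≤ n) with h8 | rfl | h10
    · exact absurd h3 (phi_ne_of_lt hN hk (by omega) h8)
    · norm_num at h3
      exact ⟨rfl, phi_nine hN hk h3⟩
    · have := phi_pos hN hk h10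
      linarith
  · rcases (show 8 ≤ n by omega).eq_or_lt with rfl | h9
    · obtain rfl : b = 4 := by omega
      refine Or.inr (Or.inr (Or.inr ⟨rfl, rfl, psi_eight hN hk ?_⟩))
      have h1 := qbinom_four_mul hn (by omega)
      rw [h] at h1
      norm_num at h1 pn
      exact mul_left_cancel₀ pn.ne' (by linarith)
    · exfalso
      have h3 := adjoint_lt_qbinom_four hN hk h9
      rcases hb4.eq_or_lt with rfl | hb5
      · linarith
      -- The end values at 4 and n - 4 agree by symmetry, and both already exceed the adjoint
      -- dimension.
      have h4 := min_lt_of_logConcave (f := qbinom N n) (lo := 4) (hi := n - 4) (m := b)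
        (fun t _ ht => qbinom_pos hn (by omega))
        (fun t ht1 ht2 => qbinom_logConcave (by omega) (by omega) (by omega)) hb5 (by omega)
      rw [qbinom_symm (by omega), min_self] at h4
      linarith

/-- The quantum binomial coefficients that equal `[n - 1] [n + 1]`. -/
theorem qbinom_eq_adjoint {n k b : ℕ} (hN : n + k = N) (hk : 2 ≤ k)
    (hb : 1 ≤ b) (hbn : b < n)
    (h : qbinom N n b = qnum N ((n : ℝ) - 1) * qnum N ((n : ℝ) + 1)) :
    N = 5 ∨ ((b = 2 ∨ b + 2 = n) ∧ k = 2) ∨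
      ((b = 3 ∨ b = 6) ∧ n = 9 ∧ (k = 3 ∨ k = 15)) ∨ (b = 4 ∧ n = 8 ∧ (k = 4 ∨ k = 6)) := by
  rcases le_total (2 * b) n with h1 | h1
  · have := qbinom_eq_adjoint_of_le hN hk hb h1 h
    omega
  · rw [← qbinom_symm hbn.le] at h
    have := qbinom_eq_adjoint_of_le hN hk (by omega) (by omega) h
    omega

theorem twoColDim_two_two_mul {n : ℕ} (hn : n + 1 < N) (h : 2 ≤ n) :
    twoColDim N n 2 2 * (qnum N 2 ^ 2 * qnum N 3) =
      qnum N n ^ 2 * (qnum N ((n : ℝ) - 1) * qnum N ((n : ℝ) + 1)) := by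
  have h2 : 2 ≤ N := by omega
  have h0 := twoColDim_zero (N := N) (n := n) (b := 0) (by omega) hn
  rw [qbinom_zero (by omega)] at h0
  have h1 := twoColDim_succ_succ hn (le_refl 0) (show 0 < n by omega)
  have h3 := twoColDim_succ_succ hn (le_refl 1) (show 1 < n by omega)
  rw [h0] at h1
  norm_num [qnum_one h2] at h1 h3
  linear_combination qnum N 2 * h3 + (qnum N ((n : ℝ) - 1) * qnum N n) * h1

/-- Compares 2Λ_2 with the adjoint object when [n] = [4], the smallest value for n, k ≥ 4: the
difference has the sign of [6] - [4], which vanishes at N = 10. -/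
theorem qnum_four_sq_sub (hN : 2 ≤ N) :
    qnum N 4 ^ 2 - qnum N 2 ^ 2 * qnum N 3 = qnum N 2 * (qnum N 6 - qnum N 4) := by
  rw [qnum_six hN, qnum_four hN, qnum_three hN]
  ring

theorem qnum_four_le {n k : ℕ} (hN : n + k = N) (hn : 4 ≤ n) (hk : 4 ≤ k) :
    qnum N 4 ≤ qnum N n := by
  have hNr : (n : ℝ) + k = N := by exact_mod_cast hN
  have hk' : (4 : ℝ) ≤ k := by exact_mod_cast hk
  have hn' : (4 : ℝ) ≤ n := by exact_mod_cast hn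
  exact qnum_mono (by omega) (by norm_num) hn' (by linarith)

theorem adjoint_le_twoColDim_two_two {n k : ℕ} (hN : n + k = N) (hn : 4 ≤ n) (hk : 4 ≤ k)
    (h10 : 10 ≤ N) :
    qnum N ((n : ℝ) - 1) * qnum N ((n : ℝ) + 1) ≤ twoColDim N n 2 2 := by
  have h2 : 2 ≤ N := by omega
  have h10' : (10 : ℝ) ≤ N := by exact_mod_cast h10
  have pD := qnum_adjoint_pos hN (by omega) (by omega)
  have p2 : 0 < qnum N 2 := qnum_pos h2 (by norm_num) (by linarith)
  have p3 : 0 < qnum N 3 := qnum_pos h2 (by norm_num) (by linarith)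
  have p4 : 0 < qnum N 4 := qnum_pos h2 (by norm_num) (by linarith)
  refine le_of_mul_le_mul_right ?_ (mul_pos (pow_pos p2 2) p3)
  rw [twoColDim_two_two_mul (by omega) (by omega), mul_comm]
  refine mul_le_mul_of_nonneg_right ?_ pD.le
  have h4 := qnum_four_le hN hn hk
  have h5 := qnum_four_sq_sub h2
  have h6 := qnum_mono h2 (x := 4) (y := 6) (by norm_num) (by norm_num) (by linarith)
  nlinarith

theorem twoColDim_two_two_eq_adjoint {n k : ℕ} (hN : n + k = N) (hn : 4 ≤ n) (hk : 4 ≤ k)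
    (h : twoColDim N n 2 2 = qnum N ((n : ℝ) - 1) * qnum N ((n : ℝ) + 1)) :
    N = 10 ∧ (n = 4 ∨ k = 4) := by
  have h2 : 2 ≤ N := by omega
  have hNr : (n : ℝ) + k = N := by exact_mod_cast hN
  have h8 : (8 : ℝ) ≤ N := by exact_mod_cast (by omega : 8 ≤ N)
  have pD := qnum_adjoint_pos hN (by omega) (by omega)
  have p2 : 0 < qnum N 2 := qnum_pos h2 (by norm_num) (by linarith)
  have p4 : 0 < qnum N 4 := qnum_pos h2 (by norm_num) (by linarith)
  have h1 := twoColDim_two_two_mul (N := N) (n := n) (by omega) (by omega)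
  rw [h, mul_comm] at h1
  have h3 := mul_right_cancel₀ pD.ne' h1
  have h5 := qnum_four_sq_sub h2
  by_cases hnk : n = 4 ∨ k = 4
  · refine ⟨?_, hnk⟩
    have hq : qnum N n = qnum N 4 := by
      rcases hnk with rfl | rfl
      · rfl
      · exact qnum_eq_of_add h2 hNr
    rw [h3, hq, sub_self] at h5
    have h6 : qnum N 4 = qnum N 6 := by
      rcases mul_eq_zero.1 h5.symm with h6 | h6 <;> linarith
    have := qnum_injective_of_lt h2 (x := 4) (y := 6) (by norm_num) (by norm_num) (by linarith) h6
    exact_mod_cast (by linarith : (N : ℝ) = 10)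
  · exfalso
    have hk5 : (5 : ℝ) ≤ k := by exact_mod_cast (by omega : 5 ≤ k)
    have hn5 : (5 : ℝ) ≤ n := by exact_mod_cast (by omega : 5 ≤ n)
    have h6 := qnum_mono h2 (x := 4) (y := 6) (by norm_num) (by norm_num) (by linarith)
    have h7 := qnum_strictMono h2 (x := 4) (y := 5) (by norm_num) (by norm_num) (by linarith)
    have h9 := qnum_mono h2 (x := 5) (y := n) (by norm_num) (by linarith) (by linarith)
    nlinarith

end analysis

/-! ### Minimality of the adjoint among two-column diagrams -/

section

variable {N : ℕ}

theorem twoColDim_one_two_mul {n : ℕ} (hn : n + 1 < N) (h : 2 ≤ n) :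
    twoColDim N n 1 2 * qnum N 3 =
      qnum N n * (qnum N ((n : ℝ) - 1) * qnum N ((n : ℝ) + 1)) := by
  have h2 : 2 ≤ N := by omega
  have h0 := twoColDim_zero (N := N) (n := n) (b := 2) (by omega) hn
  have h1 := twoColDim_succ_left hn (show 0 < 2 by omega) h
  have h3 := qbinom_two_mul (N := N) (n := n) (by omega) h
  rw [h0] at h1
  norm_num [qnum_one h2] at h1
  linear_combination h1 + qnum N ((n : ℝ) + 1) * h3

/-- Among the diagrams with two columns of distinct positive lengths, the adjoint one has the
smallest dimension. -/
theorem adjoint_lt_twoColDim {n k a b : ℕ} (hN : n + k = N) (hk : 3 ≤ k) (ha : 1 ≤ a)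
    (hab : a < b) (hb : b < n) :
    qnum N ((n : ℝ) - 1) * qnum N ((n : ℝ) + 1) < twoColDim N n a b ∨ (a = 1 ∧ b + 1 = n) ∨
      (k = 3 ∧ ((a = 1 ∧ b = 2) ∨ (a + 2 = n ∧ b + 1 = n))) := by
  have h2 : 2 ≤ N := by omega
  have hNr : (n : ℝ) + k = N := by exact_mod_cast hN
  have hk' : (3 : ℝ) ≤ k := by exact_mod_cast hk
  have hn3 : (3 : ℝ) ≤ n := by exact_mod_cast (by omega : 3 ≤ n)
  set D := qnum N ((n : ℝ) - 1) * qnum N ((n : ℝ) + 1) with hD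
  have pD : 0 < D := qnum_adjoint_pos hN (by omega) (by omega)
  have p3 : 0 < qnum N 3 := qnum_pos h2 (by norm_num) (by linarith)
  have e12 := twoColDim_one_two_mul (N := N) (n := n) (by omega) (by omega)
  rw [← hD] at e12
  -- The pairs (a, b) form a triangle with corners (1, 2), (1, n - 1) and (n - 2, n - 1). The
  -- corners are compared first, then the sides a = 1 and a = b - 1, and finally the interior along
  -- fixed b. The ratio at this corner is [n]/[3], so ties need n = 3 or k = 3.
  have g12 : D ≤ twoColDim N n 1 2 := by
    have := qnum_mono h2 (x := 3) (y := n) (by norm_num) hn3 (by linarith)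
    refine le_of_mul_le_mul_right ?_ p3
    rw [e12, mul_comm]
    exact mul_le_mul_of_nonneg_right this pD.le
  have g12' : 4 ≤ n → 4 ≤ k → D < twoColDim N n 1 2 := fun hn4 hk4 => by
    have hk4' : (4 : ℝ) ≤ k := by exact_mod_cast hk4
    have hn4' : (4 : ℝ) ≤ n := by exact_mod_cast hn4
    have := qnum_strictMono h2 (x := 3) (y := n) (by norm_num) (by linarith) (by linarith)
    refine lt_of_mul_lt_mul_right ?_ p3.le
    rw [e12, mul_comm]
    exact mul_lt_mul_of_pos_right this pD
  have gadj : twoColDim N n 1 (n - 1) = D := twoColDim_adjoint (by omega) (by omega)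
  have gsymm : twoColDim N n (n - 1 - 1) (n - 1) = twoColDim N n 1 2 := by
    rw [← twoColDim_symm (a := 1) (b := 2) (by omega) (by omega)]
    rfl
  have hone : ∀ t, 2 < t → t < n - 1 → D < twoColDim N n 1 t := fun t h1 h3 => by
    have := min_lt_of_logConcave (f := twoColDim N n 1) (lo := 2) (hi := n - 1) (m := t)
      (fun s _ _ => twoColDim_pos (by omega) (by omega) (by omega))
      (fun s _ _ => twoColDim_logConcave_right (by omega) (by omega) (by omega)) h1 h3
    rw [gadj, min_eq_right g12] at this
    exact this
  have hdiag : ∀ t, 2 < t → t < n - 1 → D < twoColDim N n (t - 1) t := fun t h1 h3 => by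
    have := min_lt_of_logConcave (f := fun s => twoColDim N n (s - 1) s) (lo := 2) (hi := n - 1)
      (m := t) (fun s _ _ => twoColDim_pos (by omega) (by omega) (by omega))
      (fun s _ _ => by
        have h4 := twoColDim_logConcave_diag (N := N) (n := n) (a := s - 1) (b := s) (by omega)
          (by omega) (by omega) (by omega)
        rwa [show s - 1 + 1 = s + 1 - 1 by omega] at h4) h1 h3
    simp only [gsymm, Nat.add_one_sub_one] at this
    rw [min_self] at this
    exact g12.trans_lt this
  have hone' : ∀ t, 2 ≤ t → t ≤ n - 1 → D ≤ twoColDim N n 1 t := fun t h1 h3 => by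
    rcases h1.eq_or_lt with rfl | h1
    · exact g12
    rcases h3.eq_or_lt with rfl | h3
    · exact gadj.ge
    exact (hone t h1 h3).le
  have hdiag' : ∀ t, 2 ≤ t → t ≤ n - 1 → D ≤ twoColDim N n (t - 1) t := fun t h1 h3 => by
    rcases h1.eq_or_lt with rfl | h1
    · exact g12
    rcases h3.eq_or_lt with rfl | h3
    · rw [gsymm]; exact g12
    exact (hdiag t h1 h3).le
  rcases ha.eq_or_lt with rfl | ha
  · rcases (show 2 ≤ b from hab).eq_or_lt with rfl | hb2
    · by_cases hn : 4 ≤ n ∧ 4 ≤ k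
      · exact Or.inl (g12' hn.1 hn.2)
      · right; omega
    · by_cases hn : b < n - 1
      · exact Or.inl (hone b hb2 hn)
      · right; omega
  · by_cases hab' : a < b - 1
    · left
      have := min_lt_of_logConcave (f := fun s => twoColDim N n s b) (lo := 1) (hi := b - 1)
        (m := a) (fun s _ _ => twoColDim_pos (by omega) (by omega) (by omega))
        (fun s _ _ => twoColDim_logConcave_left (by omega) (by omega) (by omega) (by omega))
        ha hab'
      exact (le_min (hone' b (by omega) (by omega)) (hdiag' b (by omega) (by omega))).trans_lt this
    · obtain rfl : a = b - 1 := by omega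
      by_cases hn : b < n - 1
      · exact Or.inl (hdiag b (by omega) hn)
      · obtain rfl : b = n - 1 := by omega
        by_cases hk4 : 4 ≤ k
        · left
          rw [gsymm]
          exact g12' (by omega) hk4
        · right; right; omega

end

/-! ### Objects with at least three nonzero labels -/

namespace SimpleObj

variable {r k : ℕ}

theorem label_current_single (X : SimpleObj r k) {u v w : Fin (r + 1)} {c d e : ℕ}
    (h : X.label = Pi.single u c + Pi.single v d + Pi.single w e) (t : Fin (r + 1)) :
    (X.current t).label = Pi.single (u + t) c + Pi.single (v + t) d + Pi.single (w + t) e := by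
  ext i
  simp only [current, h, Pi.add_apply, Pi.single_apply, sub_eq_iff_eq_add]

theorem twoCol_comm (h : 2 ≤ k) (a b : Fin (r + 1)) : twoCol h a b = twoCol h b a := by
  ext i
  simp only [twoCol, Pi.add_apply]
  ring

theorem multiple_one_eq (h : 2 ≤ k) (b : Fin (r + 1)) :
    multiple 1 b (by omega) = twoCol h 0 b := by
  ext i
  simp only [twoCol, multiple, Pi.add_apply, Pi.single_apply]
  split_ifs <;> omega

theorem multiple_two_eq (h : 2 ≤ k) (b : Fin (r + 1)) : multiple 2 b h = twoCol h b b := by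
  ext i
  simp only [twoCol, multiple, Pi.add_apply, Pi.single_apply]
  split_ifs <;> omega

theorem adjoint_eq (h : 2 ≤ k) : (adjoint h : SimpleObj r k) = twoCol h 1 (Fin.last r) := rfl

/-- The two labels of aΛ_b exchange their roles, so a may be replaced by k - a at the price of
negating b. -/
theorem multiple_current_neg {a : ℕ} (h : a ≤ k) (b : Fin (r + 1)) :
    (multiple a b h).current (-b) = multiple (k - a) (-b) (by omega) := by
  ext i
  simp only [multiple, current, Pi.add_apply, Pi.single_apply, sub_neg_eq_add, add_eq_right,
    eq_neg_iff_add_eq_zero]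
  split_ifs <;> omega

theorem conj_multiple {a : ℕ} (h : a ≤ k) (b : Fin (r + 1)) :
    (multiple a b h).conj = multiple a (-b) h := by
  ext i
  simp only [multiple, conj, Pi.add_apply, Pi.single_apply, neg_eq_iff_eq_neg, neg_zero]

theorem realDim_adjoint (hr : 1 ≤ r) (hk : 2 ≤ k) : (adjoint hk : SimpleObj r k).realDim =
    qnum (r + 1 + k) (((r + 1 : ℕ) : ℝ) - 1) * qnum (r + 1 + k) (((r + 1 : ℕ) : ℝ) + 1) := by
  have h1 : ((1 : Fin (r + 1)) : ℕ) = 1 := by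
    rw [Fin.val_one']; exact Nat.mod_eq_of_lt (by omega)
  rw [adjoint_eq, realDim_twoCol hk _ _ (Fin.le_last _), h1, Fin.val_last,
    ← twoColDim_adjoint (by omega) (by omega)]
  rfl

/-- Moving one unit between two labels in a suitable direction decreases the dimension. -/
theorem exists_realDim_lt (hk : 1 ≤ k) (X : SimpleObj r k) {a b : Fin (r + 1)} (hab : a ≠ b)
    (ha : 1 ≤ X.label a) (hb : 1 ≤ X.label b) :
    ∃ (Y : SimpleObj r k) (c : Fin (r + 1)), (c = a ∨ c = b) ∧ Y.realDim < X.realDim ∧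
      ∀ i, X.label i ≤ Y.label i + if i = c then 1 else 0 := by
  have key : ∀ a b : Fin (r + 1), a ≠ b → 1 ≤ X.label b → ∃ Y : SimpleObj r k,
      ∀ i, Y.label i + (Pi.single b 1 : Fin (r + 1) → ℕ) i =
        X.label i + (Pi.single a 1 : Fin (r + 1) → ℕ) i := by
    intro a b hab hb
    have h : ∀ i, (X.label i - (Pi.single b 1 : Fin (r + 1) → ℕ) i) +
        (Pi.single b 1 : Fin (r + 1) → ℕ) i = X.label i := by
      intro i
      rw [Pi.single_apply]
      split_ifs with h
      · subst h; omega
      · omega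
    refine ⟨⟨fun i => (X.label i - (Pi.single b 1 : Fin (r + 1) → ℕ) i) +
      (Pi.single a 1 : Fin (r + 1) → ℕ) i, ?_⟩, fun i => ?_⟩
    · have h1 := X.sum_label
      rw [← Finset.sum_congr rfl fun i _ => h i, Finset.sum_add_distrib] at h1
      rw [Finset.sum_add_distrib]
      simpa using h1
    · have := h i
      simp only
      omega
  obtain ⟨Y, hY⟩ := key a b hab hb
  obtain ⟨Z, hZ⟩ := key b a hab.symm ha
  have hne : Y ≠ X := by
    rintro rfl
    have := hY a
    rw [Pi.single_eq_same, Pi.single_eq_of_ne hab] at this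
    omega
  -- X is the midpoint of the two opposite moves Y and Z, so both cannot have dimension at least
  -- that of X.
  have hlt := realDim_mul_lt hk X Y Z (fun i => by have := hY i; have := hZ i; omega) hne
  have pY := realDim_pos hk Y
  have pX := realDim_pos hk X
  by_cases h : Y.realDim < X.realDim
  · refine ⟨Y, b, Or.inr rfl, h, fun i => ?_⟩
    have := hY i
    simp only [Pi.single_apply] at this
    omega
  · refine ⟨Z, a, Or.inl rfl, by nlinarith, fun i => ?_⟩
    have := hZ i
    simp only [Pi.single_apply] at this
    omega

/-- Guarantees that a counterexample of least dimension exists. -/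
instance finite_simpleObj : Finite (SimpleObj r k) := by
  refine Finite.of_injective
    (fun (X : SimpleObj r k) (i : Fin (r + 1)) => (⟨X.label i, ?_⟩ : Fin (k + 1))) ?_
  · have := Finset.single_le_sum (f := X.label) (fun j _ => Nat.zero_le _) (Finset.mem_univ i)
    rw [X.sum_label] at this
    omega
  · intro X Y h
    ext i
    have := congrFun h i
    simpa using this

/-- The indices of the non-zero labels. -/
def support (X : SimpleObj r k) : Finset (Fin (r + 1)) := Finset.univ.filter fun i => X.label i ≠ 0

theorem mem_support (X : SimpleObj r k) (i : Fin (r + 1)) : i ∈ X.support ↔ X.label i ≠ 0 := by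
  simp [support]

theorem sum_support (X : SimpleObj r k) : ∑ i ∈ X.support, X.label i = k := by
  rw [support, Finset.sum_filter_ne_zero, X.sum_label]

theorem val_one_of_pos (hr : 1 ≤ r) : ((1 : Fin (r + 1)) : ℕ) = 1 := by
  rw [Fin.val_one']; exact Nat.mod_eq_of_lt (by omega)

/-- The ties at k = 3 are harmless: Λ_0 + Λ_1 + Λ_r rotates to Λ_0 + Λ_1 + Λ_2 and to Λ_0 + Λ_{r-1}
+ Λ_r. -/
theorem twoCol_lt_or_mem_orbit (hk : 3 ≤ k) {a b : Fin (r + 1)} (ha : a ≠ 0) (hab : a < b) :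
    (adjoint (by omega) : SimpleObj r k).realDim < (twoCol (by omega) a b : SimpleObj r k).realDim ∨
      (twoCol (by omega) a b : SimpleObj r k) ∈ (adjoint (by omega) : SimpleObj r k).orbit := by
  have hab' : (a : ℕ) < b := hab
  have hb : (b : ℕ) < r + 1 := b.2
  have ha' : 1 ≤ (a : ℕ) := Nat.one_le_iff_ne_zero.2 fun h => ha (Fin.ext h)
  have h1 := val_one_of_pos (r := r) (by omega)
  rw [realDim_adjoint (by omega), realDim_twoCol _ _ _ hab.le]
  refine (adjoint_lt_twoColDim (N := r + 1 + k) rfl hk ha' hab' hb).imp_right ?_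
  rintro (⟨h3, h4⟩ | ⟨rfl, ⟨h3, h4⟩ | ⟨h3, h4⟩⟩)
  · have ea : a = 1 := Fin.ext (by omega)
    have eb : b = Fin.last r := Fin.ext (by rw [Fin.val_last]; omega)
    rw [ea, eb]
    exact self_mem_orbit _
  · refine ⟨1, ?_⟩
    have ea : a = 1 := Fin.ext (by omega)
    have eb : b = 1 + 1 := Fin.ext (by
      rw [Fin.val_add, h1, Nat.mod_eq_of_lt] <;> omega)
    have := label_current_single (adjoint (by omega) : SimpleObj r 3) rfl 1
    apply SimpleObj.ext
    simp only [Fin.last_add_one, zero_add] at this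
    rw [this, ea, eb]
    simp only [twoCol]
    abel
  · refine ⟨-1, ?_⟩
    have eb : b = -1 := by
      rw [eq_neg_iff_add_eq_zero, ← Fin.last_add_one]
      congr 1
      exact Fin.ext (by rw [Fin.val_last]; omega)
    have ea : a + 1 = b := Fin.ext (by
      rw [Fin.val_add, h1, Nat.mod_eq_of_lt] <;> omega)
    have ea' : a = b + -1 := by rw [← ea]; abel
    have eb' : Fin.last r = b := Fin.ext (by rw [Fin.val_last]; omega)
    have := label_current_single (adjoint (by omega) : SimpleObj r 3) rfl (-1)
    apply SimpleObj.ext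
    simp only [zero_add, add_neg_cancel] at this
    rw [this, eb', ← ea', ← eb]
    simp only [twoCol]
    abel

/-- In a counterexample of least dimension no lowering move may keep three nonzero labels. A move
empties at most one label, so there are exactly three; it empties none if both labels are at least
2, so two of the three equal 1. -/
theorem three_support (hk : 2 ≤ k) (X : SimpleObj r k) (hX : 3 ≤ X.support.card) :
    (adjoint hk : SimpleObj r k).realDim < X.realDim ∨
      X ∈ (adjoint hk : SimpleObj r k).orbit := by
  by_contra hcon
  obtain ⟨Y, hY, hmin⟩ := Set.exists_min_image
    {Y : SimpleObj r k | 3 ≤ Y.support.card ∧ ¬((adjoint hk : SimpleObj r k).realDim < Y.realDim ∨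
      Y ∈ (adjoint hk : SimpleObj r k).orbit)} realDim (Set.toFinite _) ⟨X, hX, hcon⟩
  obtain ⟨hY3, hY⟩ := hY
  rw [not_or, not_lt] at hY
  have hbad : ∀ Z : SimpleObj r k, Z.realDim < Y.realDim → Z.support.card < 3 := fun Z hZ => by
    by_contra h
    refine absurd (hmin Z ⟨by omega, ?_⟩) (not_le.2 hZ)
    rintro (h1 | h1)
    · linarith [hY.1]
    · have := realDim_eq_of_mem_orbit (by omega) h1
      linarith [hY.1]
  have hcard : Y.support.card = 3 := by
    by_contra h3
    obtain ⟨a, ha, b, hb, hab⟩ := Finset.one_lt_card.1 (show 1 < Y.support.card by omega)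
    obtain ⟨Z, c, -, hZ, hZl⟩ := exists_realDim_lt (by omega) Y hab
      (Nat.one_le_iff_ne_zero.2 ((Y.mem_support a).1 ha))
      (Nat.one_le_iff_ne_zero.2 ((Y.mem_support b).1 hb))
    have hsub : Y.support.erase c ⊆ Z.support := fun i hi => by
      rw [Finset.mem_erase, mem_support] at hi
      rw [mem_support]
      have := hZl i
      rw [if_neg hi.1] at this
      omega
    have := hbad Z hZ
    have := Finset.card_le_card hsub
    have := Finset.pred_card_le_card_erase (s := Y.support) (a := c)
    omega
  have hone : ∀ a b, a ≠ b → 2 ≤ Y.label a → ¬ 2 ≤ Y.label b := by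
    intro a b hab ha hb
    obtain ⟨Z, c, hc, hZ, hZl⟩ := exists_realDim_lt (by omega) Y hab (by omega) (by omega)
    have hsub : Y.support ⊆ Z.support := fun i hi => by
      rw [mem_support] at hi ⊢
      have := hZl i
      split_ifs at this with h
      · subst h
        rcases hc with rfl | rfl <;> omega
      · omega
    have := hbad Z hZ
    have := Finset.card_le_card hsub
    omega
  obtain ⟨u, v, w, huv, huw, hvw, hs⟩ := Finset.card_eq_three.1 hcard
  have main : ∀ u v w, u ≠ v → u ≠ w → v ≠ w → Y.support = {u, v, w} → Y.label v = 1 →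
      Y.label w = 1 → False := by
    intro u v w huv huw hvw hs hv hw
    have hsum := Y.sum_support
    rw [hs, Finset.sum_insert (by simp [huv, huw]), Finset.sum_pair hvw, hv, hw] at hsum
    have hu : Y.label u ≠ 0 := (Y.mem_support u).1 (by simp [hs])
    have hlab : Y.label = Pi.single u (k - 2) + Pi.single v 1 + Pi.single w 1 := by
      ext i
      simp only [Pi.add_apply, Pi.single_apply]
      by_cases hi : i ∈ Y.support
      · rw [hs] at hi
        simp only [Finset.mem_insert, Finset.mem_singleton] at hi
        rcases hi with rfl | rfl | rfl
        · simp [huv, huw]; omega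
        · simp [huv.symm, hvw, hv]
        · simp [huw.symm, hvw.symm, hw]
      · have h0 : Y.label i = 0 := by rw [mem_support] at hi; simpa using hi
        rw [hs] at hi
        simp only [Finset.mem_insert, Finset.mem_singleton, not_or] at hi
        simp [h0, hi.1, hi.2.1, hi.2.2]
    have hrot : Y.current (-u) = twoCol hk (v - u) (w - u) := by
      apply SimpleObj.ext
      rw [Y.label_current_single hlab]
      simp [twoCol, sub_eq_add_neg]
    have hfin : ∀ a b : Fin (r + 1), a ≠ 0 → a < b → Y.current (-u) = twoCol hk a b → False := by
      intro a b ha hab h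
      have := twoCol_lt_or_mem_orbit (k := k) (by omega) ha hab
      rw [← h, realDim_current (by omega)] at this
      rcases this with h1 | h1
      · linarith [hY.1]
      · exact hY.2 (mem_orbit_of_current _ _ _ h1)
    rcases lt_trichotomy (v - u) (w - u) with h | h | h
    · exact hfin _ _ (sub_ne_zero.2 huv.symm) h hrot
    · exact hvw (sub_left_injective h)
    · exact hfin _ _ (sub_ne_zero.2 huw.symm) h (hrot.trans (twoCol_comm _ _ _))
  have hmem : ∀ i ∈ Y.support, 1 ≤ Y.label i := fun i hi =>
    Nat.one_le_iff_ne_zero.2 ((Y.mem_support i).1 hi)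
  have lu := hmem u (by simp [hs])
  have lv := hmem v (by simp [hs])
  have lw := hmem w (by simp [hs])
  have o1 := hone u v huv
  have o2 := hone u w huw
  have o3 := hone v w hvw
  by_cases c1 : 2 ≤ Y.label u
  · exact main u v w huv huw hvw hs (by omega) (by omega)
  by_cases c2 : 2 ≤ Y.label v
  · refine main v u w huv.symm hvw huw ?_ (by omega) (by omega)
    rw [hs, Finset.insert_comm]
  · refine main w u v huw.symm hvw.symm huv ?_ (by omega) (by omega)
    rw [hs]; ext i; simp only [Finset.mem_insert, Finset.mem_singleton]; tauto

/-! ### Objects with at most two nonzero labels -/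

/-- The adjoint object, or one of the exceptional objects of the same dimension. -/
def IsAdjointLike (hk : 2 ≤ k) (X : SimpleObj r k) : Prop :=
  X ∈ (adjoint hk : SimpleObj r k).orbit ∨
    (((r = 8 ∧ k = 3) ∨ (r = 8 ∧ k = 15)) ∧
      ∃ h : 1 ≤ k, X ∈ (multiple 1 3 h).orbit ∨ X ∈ (multiple 1 3 h).conj.orbit) ∨
    (((r = 2 ∧ k = 9) ∨ (r = 14 ∧ k = 9)) ∧
      ∃ h : 3 ≤ k, X ∈ (multiple 3 1 h).orbit ∨ X ∈ (multiple 3 1 h).conj.orbit) ∨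
    (((r = 3 ∧ k = 6) ∨ (r = 5 ∧ k = 4)) ∧ ∃ h : 2 ≤ k, X ∈ (multiple 2 2 h).orbit) ∨
    (((r = 7 ∧ k = 4) ∨ (r = 7 ∧ k = 6)) ∧ ∃ h : 1 ≤ k, X ∈ (multiple 1 4 h).orbit) ∨
    (((r = 3 ∧ k = 8) ∨ (r = 5 ∧ k = 8)) ∧ ∃ h : 4 ≤ k, X ∈ (multiple 4 1 h).orbit)

theorem IsAdjointLike.of_current {hk : 2 ≤ k} {X : SimpleObj r k} {a : Fin (r + 1)}
    (h : IsAdjointLike hk (X.current a)) : IsAdjointLike hk X := by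
  have key := fun Y => mem_orbit_of_current X Y a
  rcases h with h | ⟨h1, h2, h⟩ | ⟨h1, h2, h⟩ | ⟨h1, h2, h⟩ | ⟨h1, h2, h⟩ | ⟨h1, h2, h⟩
  · exact Or.inl (key _ h)
  · exact Or.inr (Or.inl ⟨h1, h2, h.imp (key _) (key _)⟩)
  · exact Or.inr (Or.inr (Or.inl ⟨h1, h2, h.imp (key _) (key _)⟩))
  · exact Or.inr (Or.inr (Or.inr (Or.inl ⟨h1, h2, key _ h⟩)))
  · exact Or.inr (Or.inr (Or.inr (Or.inr (Or.inl ⟨h1, h2, key _ h⟩))))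
  · exact Or.inr (Or.inr (Or.inr (Or.inr (Or.inr ⟨h1, h2, key _ h⟩))))

theorem realDim_multiple_one_left (hk : 2 ≤ k) (b : Fin (r + 1)) :
    (multiple 1 b (by omega) : SimpleObj r k).realDim = qbinom (r + 1 + k) (r + 1) b := by
  have hb := b.2
  rw [multiple_one_eq hk, realDim_twoCol hk _ _ (Fin.zero_le _), Fin.val_zero,
    twoColDim_zero (by omega) (by omega)]

theorem qnum_adjoint_level (hk : 2 ≤ k) :
    qnum (r + 1 + k) (((r + 1 : ℕ) : ℝ) - 1) * qnum (r + 1 + k) (((r + 1 : ℕ) : ℝ) + 1) =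
      qnum (r + 1 + k) ((k : ℝ) - 1) * qnum (r + 1 + k) ((k : ℝ) + 1) := by
  rw [qnum_eq_of_add (x := ((r + 1 : ℕ) : ℝ) - 1) (y := (k : ℝ) + 1) (by omega)
      (by push_cast; ring),
    qnum_eq_of_add (x := ((r + 1 : ℕ) : ℝ) + 1) (y := (k : ℝ) - 1) (by omega)
      (by push_cast; ring), mul_comm]

theorem neg_val {b : Fin (r + 1)} (hb : b ≠ 0) : ((-b : Fin (r + 1)) : ℕ) = r + 1 - b := by
  have : (b : ℕ) ≠ 0 := fun h => hb (Fin.ext h)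
  rw [Fin.val_neg']
  exact Nat.mod_eq_of_lt (by omega)

/-- N = 5 leaves only (r, k) = (1, 3) and (2, 2), where every candidate is a rotation of the adjoint
object. -/
theorem isAdjointLike_multiple_of_small (hr : 1 ≤ r) (hk : 2 ≤ k) (h5 : r + 1 + k = 5) (a : ℕ)
    (b : Fin (r + 1)) (h : a ≤ k) (ha0 : a ≠ 0) (ha : a ≠ k) (hb : b ≠ 0) :
    IsAdjointLike hk (multiple a b h) := by
  left
  obtain ⟨rfl, rfl⟩ | ⟨rfl, rfl⟩ : (r = 1 ∧ k = 3) ∨ (r = 2 ∧ k = 2) := by omega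
  · obtain rfl | rfl : a = 1 ∨ a = 2 := by omega
    · obtain rfl : b = 1 := by revert hb; revert b; decide
      exact ⟨1, by ext i; fin_cases i <;> rfl⟩
    · obtain rfl : b = 1 := by revert hb; revert b; decide
      exact ⟨0, by ext i; fin_cases i <;> rfl⟩
  · obtain rfl : a = 1 := by omega
    obtain rfl | rfl : b = 1 ∨ b = 2 := by revert hb; revert b; decide
    · exact ⟨2, by ext i; fin_cases i <;> rfl⟩
    · exact ⟨1, by ext i; fin_cases i <;> rfl⟩

theorem isAdjointLike_fundamental (hr : 1 ≤ r) (hk : 2 ≤ k) (b : Fin (r + 1)) (hb : b ≠ 0)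
    (h : (multiple 1 b (by omega) : SimpleObj r k).realDim =
      (adjoint hk : SimpleObj r k).realDim) :
    IsAdjointLike hk (multiple 1 b (by omega) : SimpleObj r k) := by
  have hb1 : 1 ≤ (b : ℕ) := Nat.one_le_iff_ne_zero.2 fun h => hb (Fin.ext h)
  have h1 := val_one_of_pos hr
  rw [realDim_multiple_one_left hk, realDim_adjoint hr] at h
  rcases qbinom_eq_adjoint rfl hk hb1 b.2 h with h5 | ⟨hb2, rfl⟩ | ⟨hb2, hr9, h3⟩ | ⟨hb2, hr8, h3⟩
  · exact isAdjointLike_multiple_of_small hr hk h5 1 b _ (by omega) (by omega) hb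
  -- At level 2 the adjoint object is Λ_1 + Λ_r, and rotating by ±1 gives Λ_0 + Λ_2 and Λ_0 +
  -- Λ_{r-1}.
  · left
    rcases hb2 with hb2 | hb2
    · refine ⟨1, ?_⟩
      have eb : b = 1 + 1 := Fin.ext (by rw [Fin.val_add, h1, Nat.mod_eq_of_lt] <;> omega)
      have := label_current_single (adjoint hk : SimpleObj r 2) rfl 1
      apply SimpleObj.ext
      simp only [Fin.last_add_one, zero_add] at this
      rw [this, eb]
      simp only [multiple]
      norm_num
      abel
    · refine ⟨-1, ?_⟩
      have eb : b + 1 = Fin.last r := Fin.ext (by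
        rw [Fin.val_add, h1, Nat.mod_eq_of_lt, Fin.val_last] <;> omega)
      have := label_current_single (adjoint hk : SimpleObj r 2) rfl (-1)
      apply SimpleObj.ext
      simp only [zero_add, add_neg_cancel, ← eb, add_neg_cancel_right] at this
      rw [this]
      simp only [multiple]
      norm_num
  · right; left
    obtain rfl : r = 8 := by omega
    refine ⟨by omega, by omega, ?_⟩
    rcases hb2 with hb2 | hb2
    · left
      obtain rfl : b = 3 := Fin.ext hb2
      exact self_mem_orbit _
    · right
      obtain rfl : b = 6 := Fin.ext hb2
      rw [conj_multiple]
      exact self_mem_orbit _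
  · right; right; right; right; left
    obtain rfl : r = 7 := by omega
    refine ⟨by omega, by omega, ?_⟩
    obtain rfl : b = 4 := Fin.ext hb2
    exact self_mem_orbit _

/-- The binomial classification is applied with n and k exchanged; its family at level 2 now means r
= 1, where 2Λ_1 is the adjoint object. -/
theorem isAdjointLike_row (hr : 1 ≤ r) (hk : 2 ≤ k) (a : ℕ) (h : a ≤ k) (ha0 : a ≠ 0)
    (ha : a ≠ k) (hX : (multiple a 1 h : SimpleObj r k).realDim =
      (adjoint hk : SimpleObj r k).realDim) :
    IsAdjointLike hk (multiple a 1 h : SimpleObj r k) := by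
  have h1 := val_one_of_pos hr
  rw [realDim_multiple_one hr (by omega), realDim_adjoint hr, qnum_adjoint_level hk] at hX
  rcases qbinom_eq_adjoint (N := r + 1 + k) (n := k) (k := r + 1) (by omega) (by omega) (by omega)
    (by omega) hX with h5 | ⟨ha2, hr1⟩ | ⟨ha3, rfl, h3⟩ | ⟨rfl, rfl, h3⟩
  · exact isAdjointLike_multiple_of_small hr hk h5 a 1 h ha0 ha (fun h => by
      rw [h] at h1; simp at h1)
  · left
    obtain rfl : r = 1 := by omega
    rcases ha2 with rfl | rfl
    · refine ⟨0, ?_⟩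
      ext i
      fin_cases i <;> simp [multiple, adjoint, current, Fin.last]
    · refine ⟨1, ?_⟩
      ext i
      fin_cases i
      · simp [multiple, adjoint, current, Fin.last]
        rfl
      · simp [multiple, adjoint, current, Fin.last]
  · right; right; left
    refine ⟨by omega, by omega, ?_⟩
    rcases ha3 with rfl | rfl
    · exact Or.inl (self_mem_orbit _)
    · right
      refine mem_orbit_of_current _ _ (-1) ?_
      rw [multiple_current_neg, conj_multiple]
      exact self_mem_orbit _
  · right; right; right; right; right
    exact ⟨by omega, by omega, self_mem_orbit _⟩

theorem realDim_multiple_two (hk : 2 ≤ k) (b : Fin (r + 1)) :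
    (multiple 2 b hk : SimpleObj r k).realDim = twoColDim (r + 1 + k) (r + 1) b b := by
  rw [multiple_two_eq hk, realDim_twoCol hk _ _ le_rfl]

theorem realDim_multiple_sub_two (hk : 2 ≤ k) {b : Fin (r + 1)} (hb : b ≠ 0) :
    (multiple (k - 2) b (by omega) : SimpleObj r k).realDim =
      twoColDim (r + 1 + k) (r + 1) b b := by
  have h := realDim_current (by omega) (multiple (k - 2) b (by omega) : SimpleObj r k) (-b)
  rw [multiple_current_neg] at h
  have e : (multiple (k - (k - 2)) (-b) (by omega) : SimpleObj r k) = multiple 2 (-b) hk := by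
    ext i
    simp only [multiple, Pi.add_apply]
    rw [show k - (k - 2) = 2 by omega]
  rw [← h, e, realDim_multiple_two, neg_val hb, twoColDim_symm le_rfl (by omega)]

theorem twoColDim_le_realDim_multiple (hk : 4 ≤ k) {b : Fin (r + 1)} (hb : b ≠ 0) {a : ℕ}
    (ha : 2 ≤ a) (hak : a + 2 ≤ k) (h : a ≤ k) :
    twoColDim (r + 1 + k) (r + 1) b b ≤ (multiple a b h : SimpleObj r k).realDim ∧
      (2 < a → a + 2 < k →
        twoColDim (r + 1 + k) (r + 1) b b < (multiple a b h : SimpleObj r k).realDim) := by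
  have hlt : 2 < a → a + 2 < k →
      twoColDim (r + 1 + k) (r + 1) b b < (multiple a b h : SimpleObj r k).realDim := by
    intro ha2 hak2
    -- The value 0 for t > k is never used: only 2 ≤ t ≤ k - 2 matters, and the two end values agree
    -- by conjugation.
    set f : ℕ → ℝ := fun t =>
      if ht : t ≤ k then (multiple t b ht : SimpleObj r k).realDim else 0 with hf
    have hft : ∀ t (ht : t ≤ k), f t = (multiple t b ht : SimpleObj r k).realDim :=
      fun t ht => dif_pos ht
    have := min_lt_of_logConcave (f := f) (lo := 2) (hi := k - 2) (m := a)
      (fun t _ ht => by rw [hft t (by omega)]; exact realDim_pos (by omega) _)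
      (fun t h1 h2 => by
        rw [hft t (by omega), hft (t - 1) (by omega), hft (t + 1) (by omega)]
        refine realDim_mul_lt (by omega) _ _ _ (fun i => ?_) (fun h => ?_)
        · simp only [multiple, Pi.add_apply, Pi.single_apply]
          split_ifs <;> omega
        · have := congrArg (fun Y => SimpleObj.label Y b) h
          simp [multiple, Pi.single_eq_of_ne hb] at this
          omega) ha2 (by omega)
    rw [hft 2 (by omega), hft (k - 2) (by omega), hft a h, realDim_multiple_two,
      realDim_multiple_sub_two (by omega) hb, min_self] at this
    exact this
  refine ⟨?_, hlt⟩
  rcases ha.eq_or_lt with rfl | ha2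
  · rw [realDim_multiple_two]
  rcases hak.eq_or_lt with hak | hak2
  · obtain rfl : a = k - 2 := by omega
    rw [realDim_multiple_sub_two (by omega) hb]
  exact (hlt ha2 hak2).le

theorem twoColDim_two_two_le {N n b : ℕ} (hn : n + 2 < N) (hb : 2 ≤ b) (hbn : b + 2 ≤ n) :
    twoColDim N n 2 2 ≤ twoColDim N n b b ∧
      (2 < b → b + 2 < n → twoColDim N n 2 2 < twoColDim N n b b) := by
  have hsymm : twoColDim N n (n - 2) (n - 2) = twoColDim N n 2 2 :=
    twoColDim_symm le_rfl (by omega)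
  have hlt : 2 < b → b + 2 < n → twoColDim N n 2 2 < twoColDim N n b b := by
    intro h1 h2
    have := min_lt_of_logConcave (f := fun t => twoColDim N n t t) (lo := 2) (hi := n - 2) (m := b)
      (fun t _ _ => twoColDim_pos (by omega) le_rfl (by omega))
      (fun t _ _ => twoColDim_logConcave_diag hn (by omega) le_rfl (by omega)) h1 (by omega)
    simpa only [hsymm, min_self] using this
  refine ⟨?_, hlt⟩
  rcases hb.eq_or_lt with rfl | hb2
  · exact le_rfl
  rcases hbn.eq_or_lt with hbn | hbn2
  · obtain rfl : b = n - 2 := by omega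
    exact hsymm.ge
  exact (hlt hb2 hbn2).le

/-- For N ≥ 10 the chain adjoint ≤ 2Λ_2 ≤ 2Λ_b ≤ aΛ_b must collapse, which puts a and b at the ends
of their ranges. For N < 10 the bounds on a and b leave nothing but the ends. -/
theorem isAdjointLike_rectangle (hk : 2 ≤ k) (a : ℕ) (h : a ≤ k) (ha : 2 ≤ a) (hak : a + 2 ≤ k)
    (b : Fin (r + 1)) (hb : 2 ≤ (b : ℕ)) (hbr : (b : ℕ) + 1 ≤ r)
    (hX : (multiple a b h : SimpleObj r k).realDim = (adjoint hk : SimpleObj r k).realDim) :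
    IsAdjointLike hk (multiple a b h : SimpleObj r k) := by
  have hb0 : b ≠ 0 := by rintro rfl; simp at hb
  rw [realDim_adjoint (by omega)] at hX
  have e1 := twoColDim_le_realDim_multiple (r := r) (by omega) hb0 ha hak h
  have e2 := twoColDim_two_two_le (N := r + 1 + k) (n := r + 1) (by omega) hb (by omega)
  have e3 := adjoint_le_twoColDim_two_two (N := r + 1 + k) (n := r + 1) rfl (by omega)
    (show 4 ≤ k by omega)
  have ea : a = 2 ∨ a + 2 = k := by
    by_contra hcon
    have := e1.2 (by omega) (by omega)
    have := e3 (by omega)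
    linarith [e2.1]
  have eb : (b : ℕ) = 2 ∨ (b : ℕ) + 2 = r + 1 := by
    by_contra hcon
    have := e2.2 (by omega) (by omega)
    have := e3 (by omega)
    linarith [e1.1]
  have ea' : (multiple a b h : SimpleObj r k).realDim =
      twoColDim (r + 1 + k) (r + 1) b b := by
    rcases ea with rfl | ea
    · rw [realDim_multiple_two]
    · obtain rfl : a = k - 2 := by omega
      rw [realDim_multiple_sub_two (by omega) hb0]
  have eb' : twoColDim (r + 1 + k) (r + 1) b b = twoColDim (r + 1 + k) (r + 1) 2 2 := by
    rcases eb with eb | eb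
    · rw [eb]
    · rw [← twoColDim_symm (a := 2) (b := 2) le_rfl (by omega),
        show (b : ℕ) = r + 1 - 2 by omega]
  obtain ⟨hN, h4⟩ := twoColDim_two_two_eq_adjoint (N := r + 1 + k) (n := r + 1) rfl (by omega)
    (show 4 ≤ k by omega) (by rw [← eb', ← ea', hX])
  right; right; right; left
  refine ⟨by omega, by omega, ?_⟩
  obtain ⟨rfl, rfl⟩ | ⟨rfl, rfl⟩ : (r = 3 ∧ k = 6) ∨ (r = 5 ∧ k = 4) := by omega
  · obtain rfl : b = 2 := Fin.ext (by change (b : ℕ) = 2; omega)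
    obtain rfl | rfl : a = 2 ∨ a = 4 := by omega
    · exact self_mem_orbit _
    · refine mem_orbit_of_current _ _ (-2) ?_
      rw [multiple_current_neg]
      exact self_mem_orbit _
  · obtain rfl : a = 2 := by omega
    obtain hb | hb : (b : ℕ) = 2 ∨ (b : ℕ) = 4 := by omega
    · obtain rfl : b = 2 := Fin.ext hb
      exact self_mem_orbit _
    · obtain rfl : b = 4 := Fin.ext hb
      refine mem_orbit_of_current _ _ (-4) ?_
      rw [multiple_current_neg]
      exact self_mem_orbit _

theorem isAdjointLike_multiple (hr : 1 ≤ r) (hk : 2 ≤ k) (a : ℕ) (h : a ≤ k) (ha0 : a ≠ 0)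
    (ha : a ≠ k) (b : Fin (r + 1)) (hb : b ≠ 0)
    (hX : (multiple a b h : SimpleObj r k).realDim = (adjoint hk : SimpleObj r k).realDim) :
    IsAdjointLike hk (multiple a b h : SimpleObj r k) := by
  have hX' := hX
  rw [← realDim_current (by omega) _ (-b), multiple_current_neg] at hX'
  have hb1 : (b : ℕ) ≠ 0 := fun h => hb (Fin.ext h)
  have h1 := val_one_of_pos hr
  have hnb : -b ≠ 0 := neg_ne_zero.2 hb
  by_cases ha1 : a = 1
  · subst ha1
    exact isAdjointLike_fundamental hr hk b hb hX
  by_cases hak : a + 1 = k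
  · subst hak
    refine IsAdjointLike.of_current (a := -b) ?_
    rw [multiple_current_neg]
    simp only [Nat.add_sub_cancel_left] at hX' ⊢
    exact isAdjointLike_fundamental hr hk (-b) hnb hX'
  by_cases hb1 : b = 1
  · subst hb1
    exact isAdjointLike_row hr hk a h ha0 ha hX
  by_cases hbl : b = Fin.last r
  · have hb' : -b = 1 := by rw [hbl, neg_eq_iff_add_eq_zero, Fin.last_add_one]
    refine IsAdjointLike.of_current (a := -b) ?_
    rw [multiple_current_neg]
    rw [hb'] at hX' ⊢
    exact isAdjointLike_row hr hk _ _ (by omega) (by omega) hX'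
  have hb2 : (b : ℕ) ≠ 1 := fun h => hb1 (Fin.ext (h.trans h1.symm))
  have hb3 : (b : ℕ) ≠ r := fun h => hbl (Fin.ext h)
  exact isAdjointLike_rectangle hk a h (by omega) (by omega) b (by omega) (by omega) hX

theorem isAdjointLike_of_realDim (hr : 1 ≤ r) (hk : 2 ≤ k) (X : SimpleObj r k)
    (hX : X.realDim = (adjoint hk : SimpleObj r k).realDim) : IsAdjointLike hk X := by
  by_cases h3 : 3 ≤ X.support.card
  · rcases three_support hk X h3 with h | h
    · linarith
    · exact Or.inl h
  have hzero : ∀ i, i ∉ X.support → X.label i = 0 := fun i hi => by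
    rw [mem_support] at hi; simpa using hi
  have hsum := X.sum_support
  rcases (by omega : X.support.card = 0 ∨ X.support.card = 1 ∨ X.support.card = 2) with h | h | h
  · rw [Finset.card_eq_zero.1 h, Finset.sum_empty] at hsum
    omega
  · obtain ⟨u, hu⟩ := Finset.card_eq_one.1 h
    rw [hu, Finset.sum_singleton] at hsum
    -- A single nonzero label rotates to the unit kΛ_0, of dimension 1. Then [n]² = 2, while [n] ≥
    -- [2] > 1.6 as soon as N ≥ 5.
    have hrot : X.current (-u) = multiple 0 1 (by omega) := by
      ext i
      simp only [current, multiple, Pi.add_apply, Pi.single_apply, sub_neg_eq_add]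
      by_cases hi : i = 0
      · simp [hi, hsum]
      · rw [hzero _ (by rw [hu]; simpa using hi)]
        simp [hi]
    rw [← realDim_current (by omega) X (-u), hrot, realDim_multiple_one hr (by omega),
      qbinom_zero (by omega), realDim_adjoint hr,
      qnum_sub_one_mul_add_one (by omega)] at hX
    refine IsAdjointLike.of_current (a := -u) ?_
    rw [hrot]
    have h2 : 2 ≤ r + 1 + k := by omega
    have h4 : r + 1 + k = 4 := by
      by_contra h5
      have hr' : (1 : ℝ) ≤ r := by exact_mod_cast hr
      have hk' : (2 : ℝ) ≤ k := by exact_mod_cast hk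
      have l := le_qnum_two (N := r + 1 + k) (M := 5) (by norm_num) (by omega)
      have := qnum_mono h2 (x := 2) (y := ((r + 1 : ℕ) : ℝ)) (by norm_num)
        (by push_cast; linarith) (by push_cast; linarith)
      norm_num at l
      nlinarith
    obtain ⟨rfl, rfl⟩ : r = 1 ∧ k = 2 := by omega
    exact Or.inl ⟨1, by ext i; fin_cases i <;> rfl⟩
  · obtain ⟨u, v, huv, hs⟩ := Finset.card_eq_two.1 h
    rw [hs, Finset.sum_pair huv] at hsum
    have hu := (X.mem_support u).1 (by simp [hs])
    have hv := (X.mem_support v).1 (by simp [hs])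
    have hrot : X.current (-u) = multiple (X.label v) (v - u) (by omega) := by
      ext i
      simp only [current, multiple, Pi.add_apply, Pi.single_apply, sub_neg_eq_add]
      by_cases hi : i = 0
      · have : ¬ (0 : Fin (r + 1)) = v - u := fun h => huv (sub_eq_zero.1 h.symm).symm
        simp only [hi, zero_add, if_true, this, if_false]
        omega
      by_cases hi2 : i = v - u
      · have : v - u ≠ 0 := sub_ne_zero.2 huv.symm
        simp [hi2, this]
      · rw [hzero _ (by
          rw [hs]
          simp only [Finset.mem_insert, Finset.mem_singleton, not_or]
          exact ⟨by simpa using hi, fun h => hi2 (eq_sub_of_add_eq h)⟩)]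
        simp [hi, hi2]
    refine IsAdjointLike.of_current (a := -u) ?_
    rw [← realDim_current (by omega) X (-u)] at hX
    rw [hrot] at hX ⊢
    exact isAdjointLike_multiple hr hk _ _ hv (by omega) _ (sub_ne_zero.2 huv.symm) hX

end SimpleObj

end SlFusion

theorem mainTheorem10 (r k : ℕ) (hr : 1 ≤ r) (hk : 2 ≤ k) (X : SlFusion.SimpleObj r k)
    (hX : X.dim = (SlFusion.SimpleObj.adjoint hk : SlFusion.SimpleObj r k).dim) :
    X ∈ (SlFusion.SimpleObj.adjoint hk : SlFusion.SimpleObj r k).orbit ∨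
    (((r = 8 ∧ k = 3) ∨ (r = 8 ∧ k = 15)) ∧
      ∃ h : 1 ≤ k, X ∈ (SlFusion.SimpleObj.multiple 1 3 h).orbit ∨
        X ∈ (SlFusion.SimpleObj.multiple 1 3 h).conj.orbit) ∨
    (((r = 2 ∧ k = 9) ∨ (r = 14 ∧ k = 9)) ∧
      ∃ h : 3 ≤ k, X ∈ (SlFusion.SimpleObj.multiple 3 1 h).orbit ∨
        X ∈ (SlFusion.SimpleObj.multiple 3 1 h).conj.orbit) ∨
    (((r = 3 ∧ k = 6) ∨ (r = 5 ∧ k = 4)) ∧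
      ∃ h : 2 ≤ k, X ∈ (SlFusion.SimpleObj.multiple 2 2 h).orbit) ∨
    (((r = 7 ∧ k = 4) ∨ (r = 7 ∧ k = 6)) ∧
      ∃ h : 1 ≤ k, X ∈ (SlFusion.SimpleObj.multiple 1 4 h).orbit) ∨
    (((r = 3 ∧ k = 8) ∨ (r = 5 ∧ k = 8)) ∧
      ∃ h : 4 ≤ k, X ∈ (SlFusion.SimpleObj.multiple 4 1 h).orbit) := by
  rw [SlFusion.SimpleObj.dim_eq_realDim, SlFusion.SimpleObj.dim_eq_realDim] at hX
  exact SlFusion.SimpleObj.isAdjointLike_of_realDim hr hk X (by exact_mod_cast hX)
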